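/- Let $A_N=\{0,1,\dots,N-1\}$. A circular word $[w]$ over $A_N$ is the class of a word $w$ up to cyclic permutation of its letters; for a set $X$ of words, $[X]=\{[w]: w\in X\}$. The symmetric group $\mathfrak S_N$ acts on (circular) words by permuting letters, and $\mathfrak S_N X$ denotes the set of all images of elements of $X$. A word is primitive if it is not $v^p$ for a factor $v$ and some $p>1$; a circular word is primitive if it has a primitive representative; $[v]^p=[v^p]$. The Parikh vector $\Psi(u)$ of a word $u$ records the number of occurrences of each letter. A nonempty word is balanced if for any two of its factors $u,v$ of equal length all coordinates of $\Psi(u)-\Psi(v)$ have absolute value at most $1$; a circular word is balanced if all its representatives are. For a circular word $[w]$ of length $\ell$ and $1\le n\le \ell$, the spectrum $\mathsf{spec}_n[w]$ is the set of the Parikh vectors of all factors of length $n$ of representatives of $[w]$; it is called trivial if it has exactly one element. Let $[\mathcal B_3]$ be the set of balanced circular words over $A_3$ that contain all three letters, and $[\mathfrak b_3]$ its subset of primitive ones. For coprime positive integers $k$ and $M-k$, the (lower) Christoffel word $C(k,M-k)$ over $A_2$ is read off the lattice path that starts at $(0,0)$, performs the step $(0,1)$ (letter $1$) whenever this does not lead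 strictly above the line $y=\frac{M-k}{k}x$ and the step $(1,0)$ (letter $0$) otherwise, and stops when it meets the line for the second time (after $M$ steps). Let $\mathcal C'$ be the set of those powers $C(k,M-k)^p$, $p\ge1$, of Christoffel words that contain an even number of letters $0$, and let $\mathfrak c'\subset\mathcal C'$ consist of the words $C(k,M-k)^p$ with $p=1$ for $k$ even and $p=2$ for $k$ odd. The map $\phi$ sends a word over $A_2$ to a word over $A_3$ by replacing each $1$ by $2$ and every even (second, fourth, …) occurrence of $0$ by $1$. Let $[\mathfrak f_3]$ be the set of $\mathfrak S_3$-images of the circular Fraenkel word $[0102010]$, and $[\mathcal F_3]$ the set of all powers $[f]^p$, $p\ge1$, of elements of $[\mathfrak f_3]$. Put $K_3=\max_k\binom3k=3$. **Theorem.** 1) $[\mathcal B_3]=\mathfrak S_3[\phi(\mathcal C')]\sqcup[\mathcal F_3]$ (a disjoint union). 2) $[\mathfrak b_3]=\mathfrak S_3[\phi(\mathfrak c')]\sqcup[\mathfrak f_3]$ (a disjoint union). Moreover, for every circular word in $[\mathfrak f_3]$, and for every circular word in $\mathfrak S_3[\phi(C(k,M-k))]$ with $k$ and $M-k$ positive and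 coprime and $k$ even, all non-trivial spectra have exactly $K_3=3$ elements. -/

import Mathlib

namespace CircularWords

/-! ### Words and circular words -/

/-- Words over the alphabet `A_N = {0, …, N - 1}`. -/
abbrev Word (N : ℕ) := List (Fin N)

/-- Circular words over `A_N`: words up to cyclic permutation of their letters. -/
abbrev CircWord (N : ℕ) := Cycle (Fin N)

/-- `[X]`: the circular words that have a representative in the set of words `X`. -/
def circ {N : ℕ} (X : Set (Word N)) : Set (CircWord N) :=
  {c | ∃ w ∈ X, (w : CircWord N) = c}

/-- The power `w ^ p = w w ⋯ w` (`p` times). -/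
def wordPow {N : ℕ} (w : Word N) (p : ℕ) : Word N := (List.replicate p w).flatten

/-- A word is primitive if it is not a `p`-th power of one of its factors with `p > 1`. -/
def IsPrimitive {N : ℕ} (w : Word N) : Prop :=
  ¬ ∃ v : Word N, v <:+: w ∧ ∃ p : ℕ, 1 < p ∧ w = wordPow v p

/-- A circular word is primitive if it has a primitive representative. -/
def IsCircPrimitive {N : ℕ} (c : CircWord N) : Prop :=
  ∃ w : Word N, (w : CircWord N) = c ∧ IsPrimitive w

/-- `c` is the `p`-th power of the circular word `d`: every representative of `c` is the `p`-th
power of some representative of `d`. -/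
def IsCircPow {N : ℕ} (c d : CircWord N) (p : ℕ) : Prop :=
  ∀ w : Word N, (w : CircWord N) = c → ∃ v : Word N, (v : CircWord N) = d ∧ w = wordPow v p

/-- The set of images of the circular words of `X` under all permutations of the alphabet. -/
def permImages {N : ℕ} (X : Set (CircWord N)) : Set (CircWord N) :=
  {c | ∃ σ : Equiv.Perm (Fin N), ∃ d ∈ X, c = d.map σ}

/-! ### Balance and abelian complexity -/

/-- The Parikh vector of a word: the number of occurrences of each letter. -/
def parikh {N : ℕ} (w : Word N) : Fin N → ℤ := fun a => (w.count a : ℤ)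

/-- A nonempty word is balanced if the Parikh vectors of any two of its factors of the same length
differ by at most one in each letter. -/
def IsBalanced {N : ℕ} (w : Word N) : Prop :=
  w ≠ [] ∧ ∀ u v : Word N, u <:+: w → v <:+: w → u.length = v.length →
    ∀ a : Fin N, |parikh u a - parikh v a| ≤ 1

/-- A circular word is balanced if all its representatives are. -/
def IsCircBalanced {N : ℕ} (c : CircWord N) : Prop :=
  ∀ w : Word N, (w : CircWord N) = c → IsBalanced w

/-- The `n`-spectrum of a word. -/
def spec {N : ℕ} (n : ℕ) (w : Word N) : Set (Fin N → ℤ) :=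
  {x | ∃ u : Word N, u <:+: w ∧ u.length = n ∧ x = parikh u}

/-- The `n`-spectrum of a circular word: the union of the spectra of its representatives. -/
def circSpec {N : ℕ} (n : ℕ) (c : CircWord N) : Set (Fin N → ℤ) :=
  {x | ∃ w : Word N, (w : CircWord N) = c ∧ x ∈ spec n w}

/-- The abelian complexity of a word. -/
noncomputable def abComplexity {N : ℕ} (n : ℕ) (w : Word N) : ℕ := (spec n w).ncard

/-- The abelian complexity of a circular word. -/
noncomputable def circAbComplexity {N : ℕ} (n : ℕ) (c : CircWord N) : ℕ := (circSpec n c).ncard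

/-- The words that contain all `N` letters. -/
def fullWords (N : ℕ) : Set (Word N) := {w | abComplexity 1 w = N}

/-- The balanced circular words over `A_N` (containing all `N` letters). -/
def balancedCirc (N : ℕ) : Set (CircWord N) := {c | c ∈ circ (fullWords N) ∧ IsCircBalanced c}

/-- The primitive balanced circular words over `A_N` (containing all `N` letters). -/
def primBalancedCirc (N : ℕ) : Set (CircWord N) := {c | c ∈ balancedCirc N ∧ IsCircPrimitive c}

/-- The bound `K_N = max_k (N choose k)`. -/
def boundK (N : ℕ) : ℕ := (Finset.range (N + 1)).sup (fun k => N.choose k)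

/-- All non-trivial spectra (those with more than one element) of the circular word `c` have
exactly `K` elements. -/
def AttainedByNontrivialSpectra {N : ℕ} (K : ℕ) (c : CircWord N) : Prop :=
  ∀ n : ℕ, 1 ≤ n → n ≤ c.length → circAbComplexity n c ≠ 1 → circAbComplexity n c = K

/-! ### Christoffel words -/

/-- The lattice point reached after `n` unit steps from the origin, when the step `(0, 1)` is
performed whenever it does not lead strictly above the line `y = q x`, and the step `(1, 0)`
otherwise. -/
def pathPoint (q : ℚ) : ℕ → ℕ × ℕ
  | 0 => (0, 0)
  | n + 1 =>
    if ((pathPoint q n).2 : ℚ) + 1 ≤ q * ((pathPoint q n).1 : ℚ) then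
      ((pathPoint q n).1, (pathPoint q n).2 + 1)
    else ((pathPoint q n).1 + 1, (pathPoint q n).2)

/-- The letter encoding the step that leads from `pathPoint q n` to `pathPoint q (n + 1)`:
`1` for `(0, 1)` and `0` for `(1, 0)`. -/
def pathLetter (q : ℚ) (n : ℕ) : Fin 2 :=
  if ((pathPoint q n).2 : ℚ) + 1 ≤ q * ((pathPoint q n).1 : ℚ) then 1 else 0

/-- The Christoffel word `C(k, m)` of slope `m / k`, for coprime positive `k`, `m`. The path stops
at its second common point with the line, which it reaches after `k + m` steps
(see `pathPoint_mem_line_iff`). -/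
def christoffel (k m : ℕ) : Word 2 := (List.range (k + m)).map (pathLetter ((m : ℚ) / (k : ℚ)))

theorem pathPoint_mod (k m : ℕ) (hk : 0 < k) (n : ℕ) :
    m * (pathPoint ((m : ℚ) / k) n).1 = k * (pathPoint ((m : ℚ) / k) n).2 + (m * n) % (k + m) := by
  have hk' : (0 : ℚ) < k := by exact_mod_cast hk
  have key : ∀ x y : ℕ, ((y : ℚ) + 1 ≤ (m : ℚ) / k * x) ↔ k * (y + 1) ≤ m * x := by
    intro x y
    rw [div_mul_eq_mul_div, le_div_iff₀ hk', mul_comm]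
    exact_mod_cast Iff.rfl
  induction n with
  | zero => simp [pathPoint]
  | succ n ih =>
    have hlt : (m * n) % (k + m) < k + m := Nat.mod_lt _ (by omega)
    have hs : (m * (n + 1)) % (k + m) = ((m * n) % (k + m) + m) % (k + m) := by
      rw [Nat.mod_add_mod]; congr 1
    rw [hs]
    simp only [pathPoint]
    simp only [key]
    split_ifs with h
    · have h1 : k ≤ (m * n) % (k + m) := by rw [mul_add] at h; omega
      rw [Nat.mod_eq_sub_mod (by omega), Nat.mod_eq_of_lt (by omega)]
      simp only [mul_add]
      omega
    · have h1 : (m * n) % (k + m) < k := by rw [mul_add] at h; omega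
      rw [Nat.mod_eq_of_lt (by omega)]
      simp only [mul_add]
      omega

/-- Among the first `k + m` steps, the path meets the line of slope `m / k` exactly twice: at the
origin and after step `k + m`. -/
theorem pathPoint_mem_line_iff (k m : ℕ) (hk : 0 < k) (hkm : Nat.Coprime k m) (n : ℕ)
    (hn : n ≤ k + m) :
    ((pathPoint ((m : ℚ) / k) n).2 : ℚ) = (m : ℚ) / k * ((pathPoint ((m : ℚ) / k) n).1 : ℚ) ↔
      n = 0 ∨ n = k + m := by
  have hk' : (k : ℚ) ≠ 0 := by exact_mod_cast hk.ne'
  have h := pathPoint_mod k m hk n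
  have h1 : ((pathPoint ((m : ℚ) / k) n).2 : ℚ)
      = (m : ℚ) / k * ((pathPoint ((m : ℚ) / k) n).1 : ℚ) ↔ (m * n) % (k + m) = 0 := by
    generalize pathPoint ((m : ℚ) / k) n = P at h
    rw [div_mul_eq_mul_div, eq_div_iff hk', mul_comm]
    norm_cast
    omega
  rw [h1]
  constructor
  · intro h0
    have hd : k + m ∣ n :=
      Nat.Coprime.dvd_of_dvd_mul_left (by simpa using hkm) (Nat.dvd_of_mod_eq_zero h0)
    rcases Nat.eq_zero_or_pos n with h2 | h2
    · exact Or.inl h2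
    · exact Or.inr (le_antisymm hn (Nat.le_of_dvd h2 hd))
  · rintro (rfl | rfl) <;> simp

/-- The set of all Christoffel words. -/
def christoffelWords : Set (Word 2) :=
  {w | ∃ k m : ℕ, 0 < k ∧ 0 < m ∧ Nat.Coprime k m ∧ w = christoffel k m}

/-- The set of all powers of Christoffel words. -/
def christoffelPowers : Set (Word 2) :=
  {w | ∃ c ∈ christoffelWords, ∃ p : ℕ, 1 ≤ p ∧ w = wordPow c p}

/-- The set `C'` of powers of Christoffel words with an even total number of letters `0`. -/
def evenChristoffelPowers : Set (Word 2) := {w | w ∈ christoffelPowers ∧ Even (w.count 0)}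

/-- The set `c'` of the words `C(k, m) ^ p` with `p = 1` for `k` even and `p = 2` for `k` odd. -/
def evenChristoffelWords : Set (Word 2) :=
  {w | ∃ k m : ℕ, 0 < k ∧ 0 < m ∧ Nat.Coprime k m ∧
    w = wordPow (christoffel k m) (if Even k then 1 else 2)}

/-- Replace each `1` by `2` and the letters `0` by `0` and `1` alternately, where the first `0`
becomes `0` if `b` is `false` and `1` if `b` is `true`. -/
def phiAux : Bool → Word 2 → Word 3
  | _, [] => []
  | b, a :: w => if a = 1 then 2 :: phiAux b w else (if b then 1 else 0) :: phiAux (!b) w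

/-- The map `φ`: each `1` is replaced by `2`, and each even (second, fourth, …) `0` by `1`. -/
def phi (w : Word 2) : Word 3 := phiAux false w

/-! ### The Fraenkel word over `A_3` -/

/-- The Fraenkel words `F_1 = 0`, `F_2 = F_1 1 F_1`, `F_3 = F_2 2 F_2`, over `A_3`. -/
def fraenkel₁ : Word 3 := [0]

/-- See `fraenkel₁`. -/
def fraenkel₂ : Word 3 := fraenkel₁ ++ [1] ++ fraenkel₁

/-- See `fraenkel₁`; this is the word `0102010`. -/
def fraenkel₃ : Word 3 := fraenkel₂ ++ [2] ++ fraenkel₂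

/-- The images of the circular Fraenkel word over `A_3` under permutations of the letters. -/
def fraenkelCirc : Set (CircWord 3) := permImages (circ {fraenkel₃})

/-- All powers of the images of the circular Fraenkel word over `A_3`. -/
def fraenkelCircPowers : Set (CircWord 3) :=
  {c | ∃ d ∈ fraenkelCirc, ∃ p : ℕ, 1 ≤ p ∧ IsCircPow c d p}

end CircularWords

namespace CircularWords

/-! A circular word of length `l` is an `l`-periodic sequence up to shift, and its factors are
windows of that sequence; balance says that the counts `win f a i n` of a letter in windows of
length `n` differ by at most one.

Balance makes the less frequent of two letters isolated by the other: between two of its occurrences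
the more frequent letter occurs (`SeqBalanced.isolated_of_le`). The classification then splits on
the letter frequencies.

If two frequencies agree, these two letters alternate once the third is erased. The third letter,
being balanced, has from a suitable start the prefix counts `A * n / l`, hence sits at the letters
`1` of a Christoffel word. So the sequence is `φ` of a Christoffel power up to renaming
(`exists_shift_eq_phiSeq`). The number of letters `0` must be even for the alternation to close up
around the circle.

If the frequencies are distinct, the failures of isolation force short factors, and comparing
windows of length at most five forces the continuation after a rarest letter, which gives the
Fraenkel sequence (`exists_fraenkelSeq`).

Conversely, in both families the prefix counts are floors of affine functions, which implies balance
(`seqBalanced_of_div`). Disjointness and primitivity follow from letter counts. For the spectra, a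
count coprime to the length makes each letter take exactly two values in each nontrivial length
(`attainedByNontrivialSpectra_of_coprime`). -/

/-! ### Words read off periodic sequences -/

/-- The word `f 0, f 1, …, f (n - 1)`. -/
def wordOf {α : Type*} (f : ℕ → α) (n : ℕ) : List α := (List.range n).map f

/-- The sequence `f` started at index `r`. -/
def shift {α : Type*} (f : ℕ → α) (r : ℕ) : ℕ → α := fun i => f (r + i)

/-- The number of occurrences of the letter `a` in the window `f i, …, f (i + n - 1)`. -/
def win {α : Type*} [DecidableEq α] (f : ℕ → α) (a : α) (i n : ℕ) : ℕ :=
  Nat.count (fun j => f (i + j) = a) n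

/-- Any two windows of equal length have almost the same number of occurrences of each letter. -/
def SeqBalanced {α : Type*} [DecidableEq α] (f : ℕ → α) : Prop :=
  ∀ a i j n, win f a i n ≤ win f a j n + 1

section General

variable {α : Type*}

@[simp] theorem length_wordOf (f : ℕ → α) (n : ℕ) : (wordOf f n).length = n := by simp [wordOf]

@[simp] theorem getElem_wordOf (f : ℕ → α) (n i : ℕ) (h : i < (wordOf f n).length) :
    (wordOf f n)[i] = f i := by simp [wordOf]

theorem shift_shift (f : ℕ → α) (r s : ℕ) : shift (shift f r) s = shift f (r + s) := by
  funext i; simp [shift, add_assoc]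

theorem periodic_shift {f : ℕ → α} {l : ℕ} (hf : Function.Periodic f l) (r : ℕ) :
    Function.Periodic (shift f r) l := fun i => by simp [shift, ← add_assoc, hf (r + i)]

theorem wordOf_add (f : ℕ → α) (a b : ℕ) :
    wordOf f (a + b) = wordOf f a ++ wordOf (shift f a) b := by
  simp [wordOf, List.range_add, Function.comp_def, shift]

theorem wordOf_succ (f : ℕ → α) (n : ℕ) : wordOf f (n + 1) = wordOf f n ++ [f n] := by
  simp [wordOf, List.range_succ]

theorem map_wordOf {β : Type*} (g : α → β) (f : ℕ → α) (n : ℕ) :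
    (wordOf f n).map g = wordOf (g ∘ f) n := by simp [wordOf]

theorem exists_periodic_wordOf {w : List α} (hw : w ≠ []) :
    ∃ f : ℕ → α, Function.Periodic f w.length ∧ w = wordOf f w.length := by
  have hl : 0 < w.length := List.length_pos_iff.2 hw
  refine ⟨fun i => w[i % w.length]'(Nat.mod_lt _ hl), fun i => by simp, ?_⟩
  apply List.ext_getElem
  · simp
  · intro i h1 h2
    simp [Nat.mod_eq_of_lt h1]

theorem rotate_wordOf {f : ℕ → α} {l : ℕ} (hf : Function.Periodic f l) (r : ℕ) :
    (wordOf f l).rotate r = wordOf (shift f r) l := by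
  apply List.ext_getElem
  · simp
  · intro i h1 h2
    rw [List.getElem_rotate]
    simp only [getElem_wordOf, length_wordOf, shift]
    rw [hf.map_mod_nat, add_comm]

theorem coe_eq_coe_wordOf {f : ℕ → α} {l : ℕ} (hf : Function.Periodic f l) (w : List α) :
    (w : Cycle α) = (wordOf f l : Cycle α) ↔ ∃ r, w = wordOf (shift f r) l := by
  rw [eq_comm, Cycle.coe_eq_coe]
  constructor
  · rintro ⟨r, hr⟩
    exact ⟨r, by rw [← hr, rotate_wordOf hf]⟩
  · rintro ⟨r, rfl⟩
    exact ⟨r, rotate_wordOf hf r⟩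

theorem infix_wordOf {f : ℕ → α} {l : ℕ} {u : List α} :
    u <:+: wordOf f l ↔ ∃ s n, s + n ≤ l ∧ u = wordOf (shift f s) n := by
  constructor
  · rintro ⟨s, t, h⟩
    have hl : s.length + u.length + t.length = l := by
      have := congrArg List.length h
      simpa [add_assoc] using this
    refine ⟨s.length, u.length, by omega, ?_⟩
    rw [← hl, wordOf_add, wordOf_add] at h
    have h1 := List.append_inj h (by simp)
    exact (List.append_inj h1.1 (by simp)).2
  · rintro ⟨s, n, h, rfl⟩
    obtain ⟨t, rfl⟩ := Nat.exists_eq_add_of_le h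
    exact ⟨wordOf f s, wordOf (shift f (s + n)) t, by rw [wordOf_add, wordOf_add]⟩

theorem flatten_replicate_wordOf {f : ℕ → α} {l : ℕ} (hf : Function.Periodic f l) (p : ℕ) :
    (List.replicate p (wordOf f l)).flatten = wordOf f (p * l) := by
  induction p with
  | zero => simp [wordOf]
  | succ p ih =>
    rw [List.replicate_succ', List.flatten_append, ih, Nat.succ_mul, wordOf_add]
    have : shift f (p * l) = f := by
      funext i
      rw [shift, add_comm, ← Nat.nsmul_eq_mul, hf.nsmul]
    simp [this]

/-! ### Counting letters in windows of periodic sequences. -/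

variable [DecidableEq α]

theorem count_wordOf (f : ℕ → α) (n : ℕ) (a : α) : (wordOf f n).count a = win f a 0 n := by
  induction n with
  | zero => simp [wordOf, win]
  | succ n ih =>
    rw [wordOf_succ, List.count_append, ih, win, win, Nat.count_succ]
    simp [List.count_singleton]

theorem win_add (f : ℕ → α) (a : α) (i m n : ℕ) :
    win f a i (m + n) = win f a i m + win f a (i + m) n := by
  simp [win, Nat.count_add, add_assoc]

theorem win_zero (f : ℕ → α) (a : α) (i : ℕ) : win f a i 0 = 0 := by simp [win]

theorem win_succ (f : ℕ → α) (a : α) (i n : ℕ) :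
    win f a i (n + 1) = win f a i n + if f (i + n) = a then 1 else 0 := by
  simp [win, Nat.count_succ]

theorem win_congr {f g : ℕ → α} {a : α} {i j n : ℕ} (h : ∀ k < n, f (i + k) = g (j + k)) :
    win f a i n = win g a j n := by
  induction n with
  | zero => simp [win_zero]
  | succ n ih => rw [win_succ, win_succ, ih fun k hk => h k (by omega), h n (by omega)]

theorem win_shift (f : ℕ → α) (a : α) (r i n : ℕ) : win (shift f r) a i n = win f a (r + i) n :=
  win_congr fun k _ => by rw [shift, add_assoc]

theorem win_mod {f : ℕ → α} {l : ℕ} (hf : Function.Periodic f l) (a : α) (i n : ℕ) :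
    win f a (i % l) n = win f a i n := by
  apply win_congr
  intro k _
  rw [← hf.map_mod_nat (i % l + k), ← hf.map_mod_nat (i + k), Nat.mod_add_mod]

theorem win_add_period {f : ℕ → α} {l : ℕ} (hf : Function.Periodic f l) (a : α) (i n : ℕ) :
    win f a (i + l) n = win f a i n := by
  rw [← win_mod hf, Nat.add_mod_right, win_mod hf]

theorem win_period {f : ℕ → α} {l : ℕ} (hf : Function.Periodic f l) (a : α) (i : ℕ) :
    win f a i l = win f a 0 l := by
  have h1 := win_add f a 0 i l
  have h2 := win_add f a 0 l i
  rw [add_comm l i] at h2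
  have h3 := win_add_period hf a 0 i
  simp only [zero_add] at h1 h2 h3
  omega

theorem win_mul_period {f : ℕ → α} {l : ℕ} (hf : Function.Periodic f l) (a : α) (i p : ℕ) :
    win f a i (p * l) = p * win f a 0 l := by
  induction p with
  | zero => simp [win_zero]
  | succ p ih => rw [Nat.add_one_mul, win_add, ih, win_period hf a (i + p * l), Nat.add_one_mul]

theorem win_eq_zero {f : ℕ → α} {a : α} {i n : ℕ} (h : ∀ k < n, f (i + k) ≠ a) :
    win f a i n = 0 := by
  induction n with
  | zero => simp [win_zero]
  | succ n ih => rw [win_succ, ih fun k hk => h k (by omega), if_neg (h n (by omega))]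

theorem win_le (f : ℕ → α) (a : α) (i n : ℕ) : win f a i n ≤ n := by
  induction n with
  | zero => simp [win_zero]
  | succ n ih => rw [win_succ]; split_ifs <;> omega

theorem win_comp_equiv {β : Type*} [DecidableEq β] (σ : α ≃ β) (f : ℕ → α) (b : β) (i n : ℕ) :
    win (σ ∘ f) b i n = win f (σ.symm b) i n := by
  simp [win, Equiv.eq_symm_apply]

theorem SeqBalanced.comp_equiv {β : Type*} [DecidableEq β] {f : ℕ → α} (hf : SeqBalanced f)
    (σ : α ≃ β) : SeqBalanced (σ ∘ f) := fun b i j n => by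
  rw [win_comp_equiv, win_comp_equiv]; exact hf _ _ _ _

theorem exists_win_pos {f : ℕ → α} {l : ℕ} (hf : Function.Periodic f l) (hl : 0 < l) {a : α} :
    0 < win f a 0 l ↔ ∃ i, f i = a := by
  constructor
  · intro h
    by_contra! hn
    rw [win_eq_zero fun k _ => hn _] at h
    exact lt_irrefl _ h
  · rintro ⟨i, hi⟩
    rw [← win_period hf a i, show l = 1 + (l - 1) by omega, win_add, win_succ, win_zero, add_zero,
      if_pos hi]
    omega

/-- Window counts are almost constant as soon as this holds for pairs of windows that fit into one
period. -/
theorem win_le_of_fit {f : ℕ → α} {l : ℕ} (hf : Function.Periodic f l) (hl : 0 < l) (a : α)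
    (h : ∀ r s t n, s + n ≤ l → t + n ≤ l → win f a (r + s) n ≤ win f a (r + t) n + 1)
    (i j n : ℕ) : win f a i n ≤ win f a j n + 1 := by
  -- Two circular windows of length at most `l / 2` lie in one representative, cut at the start of
  -- one of them.
  have short : ∀ i j n, 2 * n ≤ l → win f a i n ≤ win f a j n + 1 := by
    intro i j n hn
    rw [← win_mod hf a i, ← win_mod hf a j]
    have hi := Nat.mod_lt i hl
    have hj := Nat.mod_lt j hl
    generalize i % l = i at *
    generalize j % l = j at *
    rcases le_total i j with hij | hij
    · by_cases hc : j + n ≤ i + l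
      · have := h i 0 (j - i) n (by omega) (by omega)
        rwa [add_zero, Nat.add_sub_cancel' hij] at this
      · have := h j (i + l - j) 0 n (by omega) (by omega)
        rwa [add_zero, Nat.add_sub_cancel' (by omega), win_add_period hf] at this
    · by_cases hc : i + n ≤ j + l
      · have := h j (i - j) 0 n (by omega) (by omega)
        rwa [add_zero, Nat.add_sub_cancel' hij] at this
      · have := h i 0 (j + l - i) n (by omega) (by omega)
        rwa [add_zero, Nat.add_sub_cancel' (by omega), win_add_period hf] at this
  -- A longer window is the complement of a short one within a period, whose letter count does not
  -- depend on its start.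
  have key : ∀ i j n, n < l → win f a i n ≤ win f a j n + 1 := by
    intro i j n hn
    by_cases h2 : 2 * n ≤ l
    · exact short i j n h2
    · have h3 := short (j + n) (i + n) (l - n) (by omega)
      have h4 := win_add f a i n (l - n)
      have h5 := win_add f a j n (l - n)
      rw [Nat.add_sub_cancel' hn.le, win_period hf] at h4 h5
      omega
  have e : ∀ i, win f a i n = win f a i (n % l) + (n / l) * win f a 0 l := by
    intro i
    conv_lhs => rw [← Nat.mod_add_div n l]
    rw [win_add, mul_comm, win_mul_period hf]
  rw [e i, e j]
  have := key i j _ (Nat.mod_lt n hl)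
  omega

end General

/-! ### Spectra, balance and fullness of circular words in terms of window counts. -/

theorem circSpec_wordOf {N : ℕ} {f : ℕ → Fin N} {l n : ℕ} (hf : Function.Periodic f l)
    (hn : n ≤ l) :
    circSpec n (wordOf f l : CircWord N) = {x | ∃ i, x = fun a => (win f a i n : ℤ)} := by
  ext x
  constructor
  · rintro ⟨w, hw, u, hu, hun, rfl⟩
    obtain ⟨r, rfl⟩ := (coe_eq_coe_wordOf hf w).1 hw
    obtain ⟨s, n', -, rfl⟩ := infix_wordOf.1 hu
    rw [length_wordOf] at hun
    subst hun
    refine ⟨r + s, ?_⟩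
    funext a
    simp [parikh, count_wordOf, win_shift]
  · rintro ⟨i, rfl⟩
    refine ⟨_, (coe_eq_coe_wordOf hf _).2 ⟨i, rfl⟩, wordOf (shift f i) n,
      infix_wordOf.2 ⟨0, n, by omega, by simp [shift_shift]⟩, by simp, ?_⟩
    funext a
    simp [parikh, count_wordOf, win_shift]

theorem isCircBalanced_wordOf {N : ℕ} {f : ℕ → Fin N} {l : ℕ} (hf : Function.Periodic f l)
    (hl : 0 < l) : IsCircBalanced (wordOf f l : CircWord N) ↔ SeqBalanced f := by
  constructor
  · intro h a
    apply win_le_of_fit hf hl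
    intro r s t n hs ht
    have h1 := (h _ ((coe_eq_coe_wordOf hf _).2 ⟨r, rfl⟩)).2 _ _
      (infix_wordOf.2 ⟨s, n, hs, rfl⟩) (infix_wordOf.2 ⟨t, n, ht, rfl⟩) (by simp) a
    simp only [parikh, count_wordOf, win_shift, add_zero] at h1
    rw [abs_le] at h1
    omega
  · intro h w hw
    obtain ⟨r, rfl⟩ := (coe_eq_coe_wordOf hf w).1 hw
    refine ⟨List.ne_nil_of_length_pos (by simpa using hl), ?_⟩
    intro u v hu hv huv a
    obtain ⟨s, n, -, rfl⟩ := infix_wordOf.1 hu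
    obtain ⟨t, n', -, rfl⟩ := infix_wordOf.1 hv
    rw [length_wordOf, length_wordOf] at huv
    subst huv
    simp only [parikh, count_wordOf, win_shift, add_zero]
    have h1 := h a (r + s) (r + t) n
    have h2 := h a (r + t) (r + s) n
    rw [abs_le]
    omega

theorem mem_fullWords_iff {N : ℕ} (w : Word N) : w ∈ fullWords N ↔ ∀ a, a ∈ w := by
  have h1 : spec 1 w = ((w.toFinset.image fun a => parikh [a] : Finset (Fin N → ℤ)) :
      Set (Fin N → ℤ)) := by
    ext x
    simp only [spec, Set.mem_ofPred_eq, Finset.coe_image, Set.mem_image, List.coe_toFinset]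
    constructor
    · rintro ⟨u, hu, hl, rfl⟩
      obtain ⟨a, rfl⟩ := List.length_eq_one_iff.1 hl
      exact ⟨a, hu.subset (by simp), rfl⟩
    · rintro ⟨a, ha, rfl⟩
      obtain ⟨s, t, rfl⟩ := List.append_of_mem ha
      exact ⟨[a], ⟨s, t, by simp⟩, rfl, rfl⟩
  have hinj : Function.Injective fun a : Fin N => parikh [a] := by
    intro a b hab
    have := congrFun hab a
    by_contra hne
    simp [parikh, Ne.symm hne] at this
  rw [fullWords, Set.mem_ofPred_eq, abComplexity, h1, Set.ncard_coe_finset,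
    Finset.card_image_of_injective _ hinj]
  constructor
  · intro h a
    have : w.toFinset = Finset.univ := by
      rw [← Finset.card_eq_iff_eq_univ, h, Fintype.card_fin]
    rw [← List.mem_toFinset, this]
    exact Finset.mem_univ a
  · intro h
    have : w.toFinset = Finset.univ := by ext a; simp [h a]
    rw [this, Finset.card_univ, Fintype.card_fin]

theorem mem_balancedCirc_iff {N : ℕ} {f : ℕ → Fin N} {l : ℕ} (hf : Function.Periodic f l)
    (hl : 0 < l) :
    (wordOf f l : CircWord N) ∈ balancedCirc N ↔ SeqBalanced f ∧ ∀ a, 0 < win f a 0 l := by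
  have hfull : (wordOf f l : CircWord N) ∈ circ (fullWords N) ↔ ∀ a, 0 < win f a 0 l := by
    simp only [← count_wordOf, List.count_pos_iff]
    constructor
    · rintro ⟨w, hw, hwf⟩ a
      exact ((Cycle.coe_eq_coe.1 hwf).mem_iff).1 ((mem_fullWords_iff w).1 hw a)
    · intro h
      exact ⟨_, (mem_fullWords_iff _).2 h, rfl⟩
  rw [balancedCirc, Set.mem_ofPred_eq, hfull, isCircBalanced_wordOf hf hl, and_comm]

/-! ### Isolated letters -/

section Isolated

variable {α : Type*} [DecidableEq α]

/-- Between any two occurrences of `x` in `f` there is an occurrence of `y`. -/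
def Isolated (f : ℕ → α) (x y : α) : Prop :=
  ∀ i j, i < j → f i = x → f j = x → ∃ k, i < k ∧ k < j ∧ f k = y

/-- If both fail, there are two `x` with no `y` between and two `y` with no `x` between. A window as
long as the shorter of the two stretches, placed in the longer one, misses a letter that occurs
twice in the shorter one. -/
theorem SeqBalanced.isolated_or {f : ℕ → α} {x y : α} (hxy : x ≠ y) (hf : SeqBalanced f) :
    Isolated f x y ∨ Isolated f y x := by
  have main : ∀ {x y : α}, x ≠ y → ∀ i j i' j' : ℕ, i < j → f i = x → f j = x → i' < j' →
      f i' = y → f j' = y → (∀ k, i < k → k < j → f k ≠ y) → (∀ k, i' < k → k < j' → f k ≠ x) →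
      j' - i' ≤ j - i → False := by
    intro x y hxy i j i' j' hij hi hj hij' hi' hj' hk hk' hle
    have h1 : win f y i (j' - i' + 1) = 0 := by
      apply win_eq_zero
      intro k hkn
      by_cases h0 : k = 0
      · subst h0; simpa [hi] using hxy
      by_cases h1 : i + k = j
      · rw [h1, hj]; exact hxy
      exact hk _ (by omega) (by omega)
    have h2 : win f y i' (j' - i' + 1) = 2 + win f y (i' + 1) (j' - i' - 1) := by
      have e : j' - i' + 1 = 1 + (j' - i' - 1) + 1 := by omega
      rw [e, win_succ, win_add, win_succ, win_zero, show i' + (1 + (j' - i' - 1)) = j' by omega,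
        add_zero, if_pos hi', if_pos hj']
      omega
    have := hf y i' i (j' - i' + 1)
    omega
  by_contra! h
  obtain ⟨h1, h2⟩ := h
  simp only [Isolated] at h1 h2
  push Not at h1 h2
  obtain ⟨i, j, hij, hi, hj, hk⟩ := h1
  obtain ⟨i', j', hij', hi', hj', hk'⟩ := h2
  rcases le_total (j' - i') (j - i) with h | h
  · exact main hxy i j i' j' hij hi hj hij' hi' hj' hk hk' h
  · exact main hxy.symm i' j' i j hij' hi' hj' hij hi hj hk' hk h

theorem Isolated.win_le {f : ℕ → α} {x y : α} (hxy : x ≠ y) (h : Isolated f x y) (i n : ℕ) :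
    win f x i n ≤ win f y i n + 1 := by
  -- The induction must remember that in the case of excess some `x` has no `y` after it, so that
  -- the next letter cannot be `x`.
  have key : win f x i n ≤ win f y i n ∨ (win f x i n = win f y i n + 1 ∧
      ∃ k < n, f (i + k) = x ∧ ∀ m, k < m → m < n → f (i + m) ≠ y) := by
    induction n with
    | zero => simp [win_zero]
    | succ n ih =>
      rw [win_succ, win_succ]
      by_cases hx : f (i + n) = x
      · have hy : f (i + n) ≠ y := by rw [hx]; exact hxy
        rw [if_pos hx, if_neg hy]
        rcases ih with ih | ⟨-, k, hk, hkx, hky⟩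
        · rcases ih.lt_or_eq with ih | ih
          · left; omega
          · exact Or.inr ⟨by omega, n, by omega, hx, fun m h1 h2 => by omega⟩
        · obtain ⟨m, h1, h2, h3⟩ := h (i + k) (i + n) (by omega) hkx hx
          exact absurd (by rwa [Nat.add_sub_cancel' (by omega)]) (hky (m - i) (by omega) (by omega))
      · rw [if_neg hx]
        by_cases hy : f (i + n) = y
        · rw [if_pos hy]; left; omega
        · rw [if_neg hy]
          rcases ih with ih | ⟨h1, k, hk, hkx, hky⟩
          · left; omega
          · refine Or.inr ⟨by omega, k, by omega, hkx, fun m h2 h3 => ?_⟩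
            rcases Nat.lt_succ_iff_lt_or_eq.1 h3 with h4 | rfl
            · exact hky m h2 h4
            · exact hy
  omega

theorem Isolated.count_le {f : ℕ → α} {l : ℕ} {x y : α} (hf : Function.Periodic f l) (hxy : x ≠ y)
    (h : Isolated f x y) : win f x 0 l ≤ win f y 0 l := by
  -- Over two periods the error term `1` is too small to hide an excess in each period.
  have h1 := h.win_le hxy 0 (2 * l)
  rw [win_mul_period hf, win_mul_period hf] at h1
  omega

/-- Two `y` with no `x` between would leave all the `x` of a period, but at least two fewer `y`, in
the rest of that period, against `Isolated.win_le`. -/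
theorem Isolated.symm {f : ℕ → α} {l : ℕ} {x y : α} (hf : Function.Periodic f l) (hxy : x ≠ y)
    (hx : 0 < win f x 0 l) (hle : win f y 0 l ≤ win f x 0 l) (h : Isolated f x y) :
    Isolated f y x := by
  intro i j hij hi hj
  by_contra! hn
  have e1 := win_period hf x i
  have e2 := win_period hf y i
  have hjl : j < i + l := by
    by_contra hc
    rw [win_eq_zero] at e1
    · omega
    intro k hk
    by_cases h0 : k = 0
    · subst h0; rw [add_zero, hi]; exact hxy.symm
    · exact hn _ (by omega) (by omega)
  have e : l = (j - i + 1) + (l - (j - i + 1)) := by omega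
  rw [e, win_add, ← e] at e1 e2
  have h1 : win f x i (j - i + 1) = 0 := by
    apply win_eq_zero
    intro k hk
    by_cases h0 : k = 0
    · subst h0; rw [add_zero, hi]; exact hxy.symm
    by_cases h1 : i + k = j
    · rw [h1, hj]; exact hxy.symm
    exact hn _ (by omega) (by omega)
  have h2 : 2 ≤ win f y i (j - i + 1) := by
    have e : j - i + 1 = 1 + (j - i - 1) + 1 := by omega
    rw [e, win_succ, win_add, win_succ, win_zero, show i + (1 + (j - i - 1)) = j by omega,
      add_zero, if_pos hi, if_pos hj]
    omega
  have h3 := h.win_le hxy (i + (j - i + 1)) (l - (j - i + 1))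
  omega

theorem SeqBalanced.isolated_of_le {f : ℕ → α} {l : ℕ} {x y : α} (hb : SeqBalanced f)
    (hf : Function.Periodic f l) (hxy : x ≠ y) (hx : 0 < win f x 0 l)
    (hle : win f y 0 l ≤ win f x 0 l) : Isolated f y x := by
  rcases hb.isolated_or hxy with h | h
  · exact h.symm hf hxy hx hle
  · exact h

end Isolated

/-! ### Balanced sequences with three distinct letter frequencies -/

/-- The periodic Fraenkel sequence, started at its letter `2`. -/
def fraenkelSeq (n : ℕ) : Fin 3 :=
  if n % 7 = 0 then 2 else if n % 7 = 2 ∨ n % 7 = 5 then 1 else 0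

theorem fin_three_cases (a : Fin 3) : a = 0 ∨ a = 1 ∨ a = 2 := by
  fin_cases a <;> simp

theorem win_sum_three (f : ℕ → Fin 3) (i n : ℕ) : win f 0 i n + win f 1 i n + win f 2 i n = n := by
  induction n with
  | zero => simp [win_zero]
  | succ n ih =>
    simp only [win_succ]
    rcases fin_three_cases (f (i + n)) with h | h | h <;> simp [h] <;> omega

theorem exists_zero_zero_or {f : ℕ → Fin 3} (i20 : Isolated f 2 0) (n01 : ¬ Isolated f 0 1) :
    (∃ i, f i = 0 ∧ f (i + 1) = 0) ∨ ∃ i, f i = 0 ∧ f (i + 1) = 2 ∧ f (i + 2) = 0 := by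
  have adj2 : ∀ i, f i = 2 → f (i + 1) ≠ 2 := fun i h h' => by
    obtain ⟨k, h1, h2, -⟩ := i20 i (i + 1) (by omega) h h'
    omega
  simp only [Isolated] at n01
  push Not at n01
  obtain ⟨i, j, hij, hi, hj, hk⟩ := n01
  rcases fin_three_cases (f (i + 1)) with h | h | h
  · exact Or.inl ⟨i, hi, h⟩
  · rcases eq_or_ne (i + 1) j with rfl | hne
    · simp [h] at hj
    · exact absurd h (hk _ (by omega) (by omega))
  · rcases eq_or_ne (i + 1) j with rfl | hne
    · simp [h] at hj
    right
    refine ⟨i, hi, h, ?_⟩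
    rcases eq_or_ne (i + 2) j with rfl | hne
    · exact hj
    rcases fin_three_cases (f (i + 2)) with h' | h' | h'
    · exact h'
    · exact absurd h' (hk _ (by omega) (by omega))
    · exact absurd h' (adj2 _ h)

theorem exists_one_block {f : ℕ → Fin 3} (i10 : Isolated f 1 0) (n12 : ¬ Isolated f 1 2) :
    ∃ i j, 0 < j ∧ f i = 1 ∧ f (i + j + 1) = 1 ∧ ∀ k, 0 < k → k ≤ j → f (i + k) = 0 := by
  have adj1 : ∀ i, f i = 1 → f (i + 1) ≠ 1 := fun i h h' => by
    obtain ⟨k, h1, h2, -⟩ := i10 i (i + 1) (by omega) h h'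
    omega
  simp only [Isolated] at n12
  push Not at n12
  obtain ⟨i, j, hij, hi, hj, hk⟩ := n12
  have hex : ∃ k, f (i + k + 1) = 1 := ⟨j - i - 1, by rwa [show i + (j - i - 1) + 1 = j by omega]⟩
  classical
  have hs := Nat.find_spec hex
  have hmin := fun k => @Nat.find_min _ _ hex k
  have hle : Nat.find hex ≤ j - i - 1 := Nat.find_min' hex (by
    rwa [show i + (j - i - 1) + 1 = j by omega])
  generalize Nat.find hex = m at *
  refine ⟨i, m, ?_, hi, hs, ?_⟩
  · rcases Nat.eq_zero_or_pos m with rfl | h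
    · exact absurd hs (adj1 _ hi)
    · exact h
  · intro k h0 hkm
    rcases fin_three_cases (f (i + k)) with h | h | h
    · exact h
    · exact absurd (by rwa [show i + (k - 1) + 1 = i + k by omega]) (hmin (k - 1) (by omega))
    · exact absurd h (hk _ (by omega) (by omega))

/-- A factor `00` forces a `0` into every window of length two. If only `020` is at hand, then `101`
is excluded by balance, so the block between two `1` contains `00`. -/
theorem eq_zero_or_succ_eq_zero {f : ℕ → Fin 3} (hb : SeqBalanced f) (i10 : Isolated f 1 0)
    (i20 : Isolated f 2 0) (n01 : ¬ Isolated f 0 1) (n12 : ¬ Isolated f 1 2) (k : ℕ) :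
    f k = 0 ∨ f (k + 1) = 0 := by
  have b2 : ∀ a i j, win f a i 2 ≤ win f a j 2 + 1 := fun a i j => hb a i j 2
  have b3 : ∀ a i j, win f a i 3 ≤ win f a j 3 + 1 := fun a i j => hb a i j 3
  simp only [win_succ, win_zero, add_zero, zero_add] at b2 b3
  obtain ⟨i, j, hj, hi, hij, hz⟩ := exists_one_block i10 n12
  have zz : ∃ i, f i = 0 ∧ f (i + 1) = 0 := by
    rcases exists_zero_zero_or i20 n01 with A | ⟨i', h1, h2, h3⟩
    · exact A
    · rcases eq_or_ne j 1 with rfl | hne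
      · have := b3 1 i i'
        rw [h1, h2, h3, hi, hz 1 (by omega) (by omega), hij] at this
        simp at this
      · exact ⟨i + 1, hz 1 (by omega) (by omega), hz 2 (by omega) (by omega)⟩
  obtain ⟨i', h1, h2⟩ := zz
  have := b2 0 i' k
  by_contra! hn
  rw [h1, h2, if_neg hn.1, if_neg hn.2] at this
  simp at this

/-- Length one would give `101` against the `020` around a letter `2`. Length at least three would
put too many zeros around that `2`. -/
theorem one_block_length {f : ℕ → Fin 3} (hb : SeqBalanced f) (pair : ∀ k, f k = 0 ∨ f (k + 1) = 0)
    {i j p : ℕ} (hj : 0 < j) (hi : f i = 1) (hij : f (i + j + 1) = 1)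
    (hz : ∀ k, 0 < k → k ≤ j → f (i + k) = 0) (hpj : j < p) (hp : f p = 2) : j = 2 := by
  have hj1 : j ≠ 1 := by
    have next0 : ∀ k, f k ≠ 0 → f (k + 1) = 0 := fun k h => (pair k).resolve_left h
    have prev0 : ∀ k, f (k + 1) ≠ 0 → f k = 0 := fun k h => (pair k).resolve_right h
    have b3 : ∀ a i j, win f a i 3 ≤ win f a j 3 + 1 := fun a i j => hb a i j 3
    simp only [win_succ, win_zero, add_zero, zero_add] at b3
    rintro rfl
    have := b3 1 i (p - 1)
    rw [show p - 1 + 1 = p by omega, show p - 1 + 2 = p + 1 by omega, hp, next0 p (by simp [hp]),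
      prev0 (p - 1) (by rw [show p - 1 + 1 = p by omega]; simp [hp]), hi,
      hz 1 (by omega) (by omega), hij] at this
    simp at this
  by_contra hne
  have w1 : win f 0 (i + 1) j = j := by
    have : ∀ n ≤ j, win f 0 (i + 1) n = n := by
      intro n
      induction n with
      | zero => simp [win_zero]
      | succ n ih =>
        intro hn
        rw [win_succ, ih (by omega), if_pos]
        rw [add_assoc, add_comm 1 n]
        exact hz _ (by omega) hn
    exact this j le_rfl
  -- Since `j` consecutive zeros occur, no window of length `j` has two nonzero letters.
  have two : ∀ s a b, a < b → b < j → f (s + a) ≠ 0 → f (s + b) ≠ 0 → False := by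
    intro s a b hab hbj ha hb'
    have h1 := hb 0 (i + 1) s j
    have e : j = a + 1 + (b - a - 1) + 1 + (j - b - 1) := by omega
    have h3 : win f 0 s j ≤ j - 2 := by
      rw [e, win_add, win_succ, win_add, win_succ,
        show s + (a + 1 + (b - a - 1)) = s + b by omega, if_neg ha, if_neg hb']
      have g1 := win_le f 0 s a
      have g2 := win_le f 0 (s + (a + 1)) (b - a - 1)
      have g3 := win_le f 0 (s + (a + 1 + (b - a - 1) + 1)) (j - b - 1)
      omega
    omega
  have r : ∀ k, 0 < k → k < j → f (p + k) = 0 := by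
    intro k h0 hk
    by_contra hn
    exact two p 0 k h0 hk (by simp [hp]) hn
  have lft : ∀ k, 0 < k → k < j → f (p - k) = 0 := by
    intro k h0 hk
    by_contra hn
    refine two (p - k) 0 k h0 hk hn ?_
    rw [Nat.sub_add_cancel (by omega), hp]
    simp
  have h1 := hb 1 i (p + 1 - j) (j + 2)
  have h3 : win f 1 (p + 1 - j) (j + 2) = 0 := by
    apply win_eq_zero
    intro k hk
    rcases lt_trichotomy (p + 1 - j + k) p with h | h | h
    · have := lft (p - (p + 1 - j + k)) (by omega) (by omega)
      rw [show p - (p - (p + 1 - j + k)) = p + 1 - j + k by omega] at this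
      simp [this]
    · simp [h, hp]
    · have := r (p + 1 - j + k - p) (by omega) (by omega)
      rw [show p + (p + 1 - j + k - p) = p + 1 - j + k by omega] at this
      simp [this]
  have h4 : win f 1 i (j + 2) = 2 + win f 1 (i + 1) j := by
    rw [show j + 2 = 1 + j + 1 by omega, win_succ, win_add, win_succ, win_zero,
      show i + (1 + j) = i + j + 1 by omega, add_zero, if_pos hi, if_pos hij]
    omega
  omega

/-- The factor `1001` forces a `1` into every window of length four, and the neighbours of a `2` are
`0`. -/
theorem two_neighbours {f : ℕ → Fin 3} (hb : SeqBalanced f) (pair : ∀ k, f k = 0 ∨ f (k + 1) = 0)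
    {i : ℕ} (hi : f i = 1) (z1 : f (i + 1) = 0) (z2 : f (i + 2) = 0) (hij : f (i + 3) = 1) :
    ∀ s, f (s + 2) = 2 → f s = 1 ∧ f (s + 1) = 0 ∧ f (s + 3) = 0 ∧ f (s + 4) = 1 := by
  have next0 : ∀ k, f k ≠ 0 → f (k + 1) = 0 := fun k h => (pair k).resolve_left h
  have prev0 : ∀ k, f (k + 1) ≠ 0 → f k = 0 := fun k h => (pair k).resolve_right h
  have b4 : ∀ a i j, win f a i 4 ≤ win f a j 4 + 1 := fun a i j => hb a i j 4
  simp only [win_succ, win_zero, add_zero, zero_add] at b4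
  have four : ∀ s, ¬ (f s ≠ 1 ∧ f (s + 1) ≠ 1 ∧ f (s + 2) ≠ 1 ∧ f (s + 3) ≠ 1) := by
    rintro s ⟨g0, g1, g2, g3⟩
    have := b4 1 i s
    rw [if_neg g0, if_neg g1, if_neg g2, if_neg g3, hi, z1, z2, hij] at this
    simp at this
  intro s hs
  have g1 : f (s + 1) = 0 := prev0 _ (by rw [hs]; simp)
  have g3 : f (s + 3) = 0 := next0 _ (by rw [hs]; simp)
  refine ⟨?_, g1, g3, ?_⟩
  · by_contra h
    exact four s ⟨h, by simp [g1], by simp [hs], by simp [g3]⟩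
  · by_contra h
    exact four (s + 1) ⟨by simp [g1], by simp [hs, add_assoc], by simp [g3, add_assoc],
      by simpa [add_assoc] using h⟩

/-- After `10201` the continuation `00102` is forced, so the letters `2` recur at distance seven. -/
theorem two_successors {f : ℕ → Fin 3} (hb : SeqBalanced f) (pair : ∀ k, f k = 0 ∨ f (k + 1) = 0)
    {i : ℕ} (hi : f i = 1) (z1 : f (i + 1) = 0) (z2 : f (i + 2) = 0) (hij : f (i + 3) = 1)
    (s : ℕ) (hs : f (s + 2) = 2) :
    f (s + 5) = 0 ∧ f (s + 6) = 0 ∧ f (s + 7) = 1 ∧ f (s + 8) = 0 ∧ f (s + 9) = 2 := by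
  have next0 : ∀ k, f k ≠ 0 → f (k + 1) = 0 := fun k h => (pair k).resolve_left h
  have around := two_neighbours hb pair hi z1 z2 hij
  have z0 : f (i + 4) = 0 := next0 (i + 3) (by rw [hij]; simp)
  have b3 : ∀ a i j, win f a i 3 ≤ win f a j 3 + 1 := fun a i j => hb a i j 3
  have b5 : ∀ a i j, win f a i 5 ≤ win f a j 5 + 1 := fun a i j => hb a i j 5
  simp only [win_succ, win_zero, add_zero, zero_add] at b3 b5
  obtain ⟨g0, g1, g3, g4⟩ := around s hs
  have no101 : ∀ t, f t = 1 → f (t + 1) = 0 → f (t + 2) ≠ 1 := by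
    intro t h0 h1 h2
    have := b3 1 t (s + 1)
    simp [add_assoc, h0, h1, h2, g1, hs, g3] at this
  have g5 : f (s + 5) = 0 := next0 _ (by rw [g4]; simp)
  have g6 : f (s + 6) = 0 := by
    rcases fin_three_cases (f (s + 6)) with h | h | h
    · exact h
    · exact absurd h (no101 _ g4 g5)
    · have := b5 2 (s + 2) i
      simp [add_assoc, hs, g3, g4, g5, h, hi, z1, z2, z0, hij] at this
  have g7 : f (s + 7) = 1 := by
    rcases fin_three_cases (f (s + 7)) with h | h | h
    · have := b3 0 (s + 5) s
      simp [add_assoc, g5, g6, h, g0, g1, hs] at this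
    · exact h
    · have := (around (s + 5) (by simpa [add_assoc] using h)).1
      simp [g5] at this
  have g8 : f (s + 8) = 0 := next0 _ (by rw [g7]; simp)
  refine ⟨g5, g6, g7, g8, ?_⟩
  rcases fin_three_cases (f (s + 9)) with h | h | h
  · have := b5 0 (s + 5) s
    simp [add_assoc, g5, g6, g7, g8, h, g0, g1, hs, g3, g4] at this
  · exact absurd h (no101 _ g7 g8)
  · exact h

theorem exists_fraenkelSeq {f : ℕ → Fin 3} {l : ℕ} (hb : SeqBalanced f)
    (hf : Function.Periodic f l) (h2 : 0 < win f 2 0 l) (h21 : win f 2 0 l < win f 1 0 l)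
    (h10 : win f 1 0 l < win f 0 0 l) : ∃ p, shift f p = fraenkelSeq := by
  have hl : 0 < l := by
    rcases Nat.eq_zero_or_pos l with rfl | h
    · simp [win_zero] at h2
    · exact h
  have i10 : Isolated f 1 0 := hb.isolated_of_le hf (by decide) (by omega) (by omega)
  have i20 : Isolated f 2 0 := hb.isolated_of_le hf (by decide) (by omega) (by omega)
  have n01 : ¬ Isolated f 0 1 := fun h => by
    have := h.count_le hf (by decide)
    omega
  have n12 : ¬ Isolated f 1 2 := fun h => by
    have := h.count_le hf (by decide)
    omega
  have pair := eq_zero_or_succ_eq_zero hb i10 i20 n01 n12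
  obtain ⟨i, j, hj, hi, hij, hz⟩ := exists_one_block i10 n12
  obtain ⟨q, hq⟩ : ∃ q, f q = 2 := (exists_win_pos hf hl).1 h2
  -- Adding periods moves a `2` beyond index `j`, so that enough letters precede it.
  obtain ⟨p, hpj, hp⟩ : ∃ p, j < p ∧ f p = 2 := by
    refine ⟨q + (j + 1) * l, ?_, ?_⟩
    · nlinarith
    · rw [← hq, ← Nat.nsmul_eq_mul, hf.nsmul]
  obtain rfl := one_block_length hb pair hj hi hij hz hpj hp
  have z1 := hz 1 (by omega) (by omega)
  have z2 := hz 2 (by omega) (by omega)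
  have around := two_neighbours hb pair hi z1 z2 hij
  have step := two_successors hb pair hi z1 z2 hij
  obtain ⟨s, rfl⟩ : ∃ s, p = s + 2 := ⟨p - 2, by omega⟩
  have per : ∀ t, f (s + 7 * t + 2) = 2 := by
    intro t
    induction t with
    | zero => exact hp
    | succ t ih =>
      have := (step _ ih).2.2.2.2
      rwa [show s + 7 * (t + 1) + 2 = s + 7 * t + 9 by omega]
  refine ⟨s + 2, ?_⟩
  funext n
  obtain ⟨g5, g6, g7, g8, -⟩ := step _ (per (n / 7))
  obtain ⟨-, -, g3, g4⟩ := around _ (per (n / 7))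
  have g2 := per (n / 7)
  have hlt := Nat.mod_lt n (show 0 < 7 by omega)
  have e : s + 2 + n = s + 7 * (n / 7) + (n % 7 + 2) := by omega
  rw [shift, e, fraenkelSeq]
  generalize s + 7 * (n / 7) = u at *
  generalize n % 7 = v at *
  interval_cases v <;> simp_all

/-! ### Christoffel words and the map `φ` -/

theorem pathLetter_eq {k : ℕ} (m : ℕ) (hk : 0 < k) (n : ℕ) :
    pathLetter ((m : ℚ) / k) n = if k ≤ (m * n) % (k + m) then 1 else 0 := by
  have hk' : (0 : ℚ) < k := by exact_mod_cast hk
  have key : ∀ x y : ℕ, ((y : ℚ) + 1 ≤ (m : ℚ) / k * x) ↔ k * (y + 1) ≤ m * x := by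
    intro x y
    rw [div_mul_eq_mul_div, le_div_iff₀ hk', mul_comm]
    exact_mod_cast Iff.rfl
  have h := pathPoint_mod k m hk n
  rw [pathLetter]
  refine if_congr ?_ rfl rfl
  rw [key, mul_add]
  omega

theorem win_pathLetter (q : ℚ) (n : ℕ) :
    win (pathLetter q) 0 0 n = (pathPoint q n).1 ∧ win (pathLetter q) 1 0 n = (pathPoint q n).2 := by
  induction n with
  | zero => simp [win_zero, pathPoint]
  | succ n ih =>
    rw [win_succ, win_succ, ih.1, ih.2, zero_add, pathLetter, pathPoint]
    split_ifs <;> simp_all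

theorem win_zero_add_win_one (h : ℕ → Fin 2) (i n : ℕ) : win h 0 i n + win h 1 i n = n := by
  induction n with
  | zero => simp [win_zero]
  | succ n ih =>
    rw [win_succ, win_succ]
    have : h (i + n) = 0 ∨ h (i + n) = 1 := by generalize h (i + n) = a; fin_cases a <;> simp
    rcases this with h | h <;> simp [h] <;> omega

theorem periodic_pathLetter {k : ℕ} (m : ℕ) (hk : 0 < k) :
    Function.Periodic (pathLetter ((m : ℚ) / k)) (k + m) := by
  intro n
  rw [pathLetter_eq m hk, pathLetter_eq m hk, mul_add, Nat.add_mul_mod_self_right]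

theorem win_pathLetter_one {k : ℕ} (m : ℕ) (hk : 0 < k) (n : ℕ) :
    win (pathLetter ((m : ℚ) / k)) 1 0 n = m * n / (k + m) := by
  have h1 := pathPoint_mod k m hk n
  have h2 := win_zero_add_win_one (pathLetter ((m : ℚ) / k)) 0 n
  rw [(win_pathLetter _ n).1, (win_pathLetter _ n).2] at h2
  rw [(win_pathLetter _ n).2]
  generalize (pathPoint ((m : ℚ) / k) n).1 = x at *
  generalize (pathPoint ((m : ℚ) / k) n).2 = y at *
  have h3 := Nat.div_add_mod (m * n) (k + m)
  have h4 : (k + m) * (m * n / (k + m)) = (k + m) * y := by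
    have : m * n = m * x + m * y := by rw [← h2]; ring
    rw [add_mul k m y]
    omega
  exact (Nat.eq_of_mul_eq_mul_left (by omega) h4).symm

/-- Equivalently, the prefix count of `0` is `k * n / (k + m)` rounded up. -/
theorem mul_win_pathLetter_zero {k : ℕ} (m : ℕ) (hk : 0 < k) (n : ℕ) :
    (k + m) * win (pathLetter ((m : ℚ) / k)) 0 0 n = k * n + (m * n) % (k + m) := by
  have h1 := pathPoint_mod k m hk n
  have h2 := win_zero_add_win_one (pathLetter ((m : ℚ) / k)) 0 n
  rw [(win_pathLetter _ n).1, (win_pathLetter _ n).2] at h2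
  rw [(win_pathLetter _ n).1, add_mul, h1, ← add_assoc, ← mul_add, h2]

theorem win_pathLetter_period {k : ℕ} (m : ℕ) (hk : 0 < k) :
    win (pathLetter ((m : ℚ) / k)) 0 0 (k + m) = k ∧
      win (pathLetter ((m : ℚ) / k)) 1 0 (k + m) = m := by
  have h1 := win_pathLetter_one m hk (k + m)
  rw [Nat.mul_div_cancel _ (by omega)] at h1
  have h2 := win_zero_add_win_one (pathLetter ((m : ℚ) / k)) 0 (k + m)
  omega

/-- The sequence analogue of `phi`. -/
def phiSeq (h : ℕ → Fin 2) (n : ℕ) : Fin 3 :=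
  if h n = 1 then 2 else if Even (win h 0 0 n) then 0 else 1

theorem phiAux_concat (b : Bool) (u : Word 2) (x : Fin 2) :
    phiAux b (u ++ [x]) = phiAux b u ++
      [if x = 1 then 2 else if (if Even (u.count 0) then b else !b) then 1 else 0] := by
  induction u generalizing b with
  | nil => by_cases hx : x = 1 <;> simp [phiAux, hx]
  | cons a u ih =>
    by_cases ha : a = 1
    · subst ha
      simp [phiAux, ih]
    · have ha' : a = 0 := by omega
      subst ha'
      by_cases he : Even (u.count 0) <;> simp [phiAux, ih, he, Nat.even_add_one]

theorem phi_wordOf (h : ℕ → Fin 2) (n : ℕ) : phi (wordOf h n) = wordOf (phiSeq h) n := by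
  induction n with
  | zero => simp [wordOf, phi, phiAux]
  | succ n ih =>
    rw [wordOf_succ, wordOf_succ, ← ih, phi, phiAux_concat, count_wordOf, ← phi, phiSeq]
    by_cases he : Even (win h 0 0 n) <;> simp [he]

theorem win_phiSeq (h : ℕ → Fin 2) (n : ℕ) :
    win (phiSeq h) 0 0 n = (win h 0 0 n + 1) / 2 ∧ win (phiSeq h) 1 0 n = win h 0 0 n / 2 ∧
      win (phiSeq h) 2 0 n = win h 1 0 n := by
  induction n with
  | zero => simp [win_zero]
  | succ n ih =>
    simp only [win_succ, zero_add, ih]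
    rw [phiSeq]
    have : h n = 0 ∨ h n = 1 := by generalize h n = a; fin_cases a <;> simp
    rcases this with h0 | h1
    · by_cases he : Even (win h 0 0 n)
      · simp only [h0, he]
        rw [Nat.even_iff] at he
        simp
        omega
      · simp only [h0, he]
        rw [Nat.even_iff] at he
        simp
        omega
    · simp [h1]

theorem periodic_phiSeq {h : ℕ → Fin 2} {l : ℕ} (hh : Function.Periodic h l)
    (he : Even (win h 0 0 l)) : Function.Periodic (phiSeq h) l := by
  intro n
  rw [phiSeq, phiSeq, hh n]
  have : win h 0 0 (n + l) = win h 0 0 n + win h 0 0 l := by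
    rw [win_add, win_period hh]
  simp only [this, Nat.even_add, he, iff_true]

/-- A window count is a difference of two floors, and equals `A * n / D` or one more according to
whether a carry occurs. -/
theorem seqBalanced_of_div {α : Type*} [DecidableEq α] {f : ℕ → α}
    (h : ∀ a, ∃ A B D, 0 < D ∧ ∀ n, win f a 0 n = (A * n + B) / D) : SeqBalanced f := by
  intro a i j n
  obtain ⟨A, B, D, hD, hw⟩ := h a
  have h1 := win_add f a 0 i n
  have h2 := win_add f a 0 j n
  simp only [hw, zero_add] at h1 h2
  rw [show A * (i + n) + B = A * i + B + A * n by ring, Nat.add_div hD] at h1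
  rw [show A * (j + n) + B = A * j + B + A * n by ring, Nat.add_div hD] at h2
  split_ifs at h1 h2 <;> omega

theorem seqBalanced_phiSeq {k : ℕ} (m : ℕ) (hk : 0 < k) :
    SeqBalanced (phiSeq (pathLetter ((m : ℚ) / k))) := by
  have hM : 0 < k + m := by omega
  have key : ∀ n, ∃ r < k + m,
      (k + m) * win (pathLetter ((m : ℚ) / k)) 0 0 n = k * n + r := fun n =>
    ⟨_, Nat.mod_lt _ hM, mul_win_pathLetter_zero m hk n⟩
  apply seqBalanced_of_div
  intro a
  rcases fin_three_cases a with rfl | rfl | rfl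
  -- With `M = k + m`, the `0`-count `⌈k n / M⌉` is halved, rounding up for the letter `0` and down
  -- for the letter `1`. Merging the nested roundings gives the offsets `2 M - 1` and `M - 1` over
  -- `2 M`.
  · refine ⟨k, 2 * (k + m) - 1, 2 * (k + m), by omega, fun n => ?_⟩
    obtain ⟨r, hr, h⟩ := key n
    rw [(win_phiSeq _ n).1, mul_comm 2, ← Nat.div_div_eq_div_mul]
    congr 1
    symm
    rw [Nat.div_eq_iff hM]
    rw [mul_comm] at h
    have e := Nat.add_one_mul (win (pathLetter ((m : ℚ) / k)) 0 0 n) (k + m)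
    constructor <;> omega
  · refine ⟨k, k + m - 1, 2 * (k + m), by omega, fun n => ?_⟩
    obtain ⟨r, hr, h⟩ := key n
    rw [(win_phiSeq _ n).2.1, mul_comm 2, ← Nat.div_div_eq_div_mul]
    congr 1
    symm
    rw [Nat.div_eq_iff hM]
    rw [mul_comm] at h
    constructor <;> omega
  · exact ⟨m, 0, k + m, hM, fun n => by rw [(win_phiSeq _ n).2.2, win_pathLetter_one m hk, add_zero]⟩

/-! ### Balanced sequences with two equal letter frequencies -/

/-- A balanced letter of a periodic sequence has, from a suitable index on, the prefix counts of a
Christoffel word. -/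
theorem exists_shift_win_eq_div {α : Type*} [DecidableEq α] {f : ℕ → α} {l : ℕ}
    (hb : SeqBalanced f) (hf : Function.Periodic f l) (hl : 0 < l) (a : α) :
    ∃ r, ∀ n, win f a r n = win f a 0 l * n / l := by
  set D : ℕ → ℤ := fun i => (l : ℤ) * win f a 0 i - (win f a 0 l : ℤ) * i with hD
  have hper : Function.Periodic D l := by
    intro i
    simp only [hD]
    rw [win_add, win_period hf]
    push_cast
    ring
  -- Starting where the deviation `D` from the mean is largest keeps all later prefix counts at or
  -- below the mean.
  obtain ⟨r, -, hr⟩ := Finset.exists_max_image (Finset.range l) D ⟨0, by simpa using hl⟩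
  refine ⟨r, fun n => ?_⟩
  have h1 : D (r + n) ≤ D r := by
    rw [← hper.map_mod_nat (r + n)]
    exact hr _ (Finset.mem_range.2 (Nat.mod_lt _ hl))
  have h2 : l * win f a r n ≤ win f a 0 l * n := by
    simp only [hD] at h1
    rw [win_add, zero_add] at h1
    push_cast at h1
    zify
    linarith
  -- Tile `n` periods by `l` windows of length `n`: each contains at most `win f a r n + 1` letters
  -- `a`, and the first one strictly fewer.
  have h3 : win f a 0 l * n < l * (win f a r n + 1) := by
    have hlt : ∀ t, win f a r ((t + 1) * n) < (t + 1) * (win f a r n + 1) := by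
      intro t
      have h4 : win f a (r + n) (t * n) ≤ t * (win f a r n + 1) := by
        induction t with
        | zero => simp [win_zero]
        | succ t ih =>
          rw [Nat.add_one_mul, win_add, Nat.add_one_mul]
          have := hb a (r + n + t * n) r n
          omega
      have e : (t + 1) * n = n + t * n := by ring
      rw [e, win_add, Nat.add_one_mul]
      omega
    have h5 := hlt (l - 1)
    rw [Nat.sub_add_cancel hl, mul_comm l n, win_mul_period hf, mul_comm n] at h5
    exact h5
  symm
  rw [Nat.div_eq_iff hl]
  rw [mul_add, mul_one] at h3
  constructor
  · linarith
  · rw [mul_comm l] at h3; omega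

/-- The letters `0` and `1` of `g` alternate off the fixed positions of `2`, so only the choice of
the first letter is free; `σ` records it. -/
theorem exists_perm_phiSeq {g : ℕ → Fin 3} {h : ℕ → Fin 2} (hgh : ∀ n, g n = 2 ↔ h n = 1)
    (h0 : g 0 ≠ 2) (i01 : Isolated g 0 1) (i10 : Isolated g 1 0) :
    ∃ σ : Equiv.Perm (Fin 3), g = σ ∘ phiSeq h := by
  obtain ⟨σ, hσ0, hσ2⟩ : ∃ σ : Equiv.Perm (Fin 3), g 0 = σ 0 ∧ σ 2 = 2 := by
    rcases fin_three_cases (g 0) with h | h | h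
    · exact ⟨1, by simpa using h, rfl⟩
    · exact ⟨Equiv.swap 0 1, by simpa using h, by decide⟩
    · exact absurd h h0
  have hcases : ∀ a : Fin 3, a = σ 0 ∨ a = σ 1 ∨ a = 2 := by
    intro a
    rcases fin_three_cases (σ.symm a) with h | h | h
    · exact Or.inl (by rw [← h]; simp)
    · exact Or.inr (Or.inl (by rw [← h]; simp))
    · exact Or.inr (Or.inr (by rw [← hσ2, ← h]; simp))
  have alt : ∀ i j, i < j → g i = g j → g i ≠ 2 → ∃ t, i < t ∧ t < j ∧ g t ≠ 2 := by
    intro i j hij he hi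
    rcases fin_three_cases (g i) with h | h | h
    · obtain ⟨t, h1, h2, h3⟩ := i01 i j hij h (he ▸ h)
      exact ⟨t, h1, h2, by simp [h3]⟩
    · obtain ⟨t, h1, h2, h3⟩ := i10 i j hij h (he ▸ h)
      exact ⟨t, h1, h2, by simp [h3]⟩
    · exact absurd h hi
  have hh0 : ∀ n, g n ≠ 2 → h n = 0 := by
    intro n hn
    have := (hgh n).not.1 hn
    omega
  -- The last letter other than `2` before index `n` is determined by the parity of the number of
  -- such letters so far.
  have last : ∀ n, 0 < n → ∃ j < n, (g j = if Even (win h 0 0 n) then σ 1 else σ 0) ∧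
      ∀ t, j < t → t < n → g t = 2 := by
    intro n hn
    induction n with
    | zero => omega
    | succ n ih =>
      rcases Nat.eq_zero_or_pos n with rfl | hn'
      · refine ⟨0, by omega, ?_, fun t h1 h2 => by omega⟩
        rw [win_succ, win_zero, zero_add, if_pos (hh0 0 h0), hσ0]
        simp
      obtain ⟨j, hj, hjg, hjt⟩ := ih hn'
      by_cases hg : g n = 2
      · refine ⟨j, by omega, ?_, fun t h1 h2 => ?_⟩
        · rw [win_succ, zero_add, (hgh n).1 hg]
          simpa using hjg
        · rcases Nat.lt_succ_iff_lt_or_eq.1 h2 with h3 | rfl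
          · exact hjt t h1 h3
          · exact hg
      · refine ⟨n, by omega, ?_, fun t h1 h2 => by omega⟩
        have hjn : g j ≠ g n := by
          intro he
          obtain ⟨t, h1, h2, h3⟩ := alt j n hj he (he ▸ hg)
          exact h3 (hjt t h1 h2)
        rw [win_succ, zero_add, if_pos (hh0 n hg)]
        simp only [Nat.even_add_one]
        by_cases he : Even (win h 0 0 n)
        · rw [if_pos he] at hjg
          rw [if_neg (not_not.2 he)]
          rcases hcases (g n) with h | h | h
          · exact h
          · exact absurd (hjg.trans h.symm) hjn
          · exact absurd h hg
        · rw [if_neg he] at hjg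
          rw [if_pos he]
          rcases hcases (g n) with h | h | h
          · exact absurd (hjg.trans h.symm) hjn
          · exact h
          · exact absurd h hg
  refine ⟨σ, ?_⟩
  funext n
  rw [Function.comp_apply, phiSeq]
  by_cases hg : g n = 2
  · rw [if_pos ((hgh n).1 hg), hσ2, hg]
  rw [if_neg ((hgh n).not.1 hg)]
  obtain ⟨j, hj, hjg, hjt⟩ := last (n + 1) (by omega)
  have hjn : j = n := by
    by_contra hne
    exact hg (hjt n (by omega) (by omega))
  rw [hjn, win_succ, zero_add, if_pos (hh0 n hg)] at hjg
  simp only [Nat.even_add_one] at hjg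
  rw [hjg]
  by_cases he : Even (win h 0 0 n) <;> simp [he]

theorem exists_shift_eq_phiSeq {f : ℕ → Fin 3} {l : ℕ} (hb : SeqBalanced f)
    (hf : Function.Periodic f l) (h0 : 0 < win f 0 0 l) (h01 : win f 0 0 l = win f 1 0 l)
    (h2 : 0 < win f 2 0 l) :
    ∃ (r k m p : ℕ) (σ : Equiv.Perm (Fin 3)), 0 < k ∧ 0 < m ∧ Nat.Coprime k m ∧ 0 < p ∧
      Even (p * k) ∧ l = p * (k + m) ∧ shift f r = σ ∘ phiSeq (pathLetter ((m : ℚ) / k)) := by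
  have hl := win_sum_three f 0 l
  -- The two equal letters together play the role of the Christoffel letter `0`; reducing its count
  -- against that of `2` gives the coprime pair, and the gcd is the exponent.
  set p := Nat.gcd (2 * win f 0 0 l) (win f 2 0 l) with hp
  have hp0 : 0 < p := Nat.gcd_pos_of_pos_right _ h2
  obtain ⟨k, hk⟩ : p ∣ 2 * win f 0 0 l := Nat.gcd_dvd_left _ _
  obtain ⟨m, hm⟩ : p ∣ win f 2 0 l := Nat.gcd_dvd_right _ _
  have hk0 : 0 < k := Nat.pos_of_ne_zero fun h => by rw [h] at hk; omega
  have hm0 : 0 < m := Nat.pos_of_ne_zero fun h => by rw [h] at hm; omega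
  have hco : Nat.Coprime k m := by
    have : p * Nat.gcd k m = p * 1 := by
      rw [← Nat.gcd_mul_left, ← hk, ← hm, mul_one]
    exact Nat.eq_of_mul_eq_mul_left hp0 this
  have hlp : l = p * (k + m) := by rw [mul_add, ← hk, ← hm]; omega
  obtain ⟨r, hr⟩ := exists_shift_win_eq_div hb hf (by omega) 2
  have hr' : ∀ n, win (shift f r) 2 0 n = win (pathLetter ((m : ℚ) / k)) 1 0 n := by
    intro n
    rw [win_shift, add_zero, hr, win_pathLetter_one m hk0, hm]
    conv_lhs => rw [hlp, mul_assoc, Nat.mul_div_mul_left _ _ hp0]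
  have hgh : ∀ n, shift f r n = 2 ↔ pathLetter ((m : ℚ) / k) n = 1 := by
    intro n
    have h3 := hr' (n + 1)
    rw [win_succ, win_succ, hr' n, zero_add] at h3
    split_ifs at h3 with h4 h5 h5
    · exact iff_of_true h4 h5
    · omega
    · omega
    · exact iff_of_false h4 h5
  have i01 : Isolated f 0 1 := hb.isolated_of_le hf (by decide) (by omega) (by omega)
  have i10 : Isolated f 1 0 := hb.isolated_of_le hf (by decide) (by omega) (by omega)
  have sh : ∀ {x y}, Isolated f x y → Isolated (shift f r) x y := by
    intro x y h i j hij hi hj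
    obtain ⟨k, h1, h2, h3⟩ := h (r + i) (r + j) (by omega) hi hj
    exact ⟨k - r, by omega, by omega, by rwa [shift, Nat.add_sub_cancel' (by omega)]⟩
  obtain ⟨σ, hσ⟩ := exists_perm_phiSeq hgh
    (by
      rw [Ne, hgh, pathLetter_eq m hk0]
      simp
      omega)
    (sh i01) (sh i10)
  exact ⟨r, k, m, p, σ, hk0, hm0, hco, hp0, ⟨win f 0 0 l, by omega⟩, hlp, hσ⟩

/-! ### Powers and primitivity -/

theorem wordPow_wordOf {N : ℕ} {f : ℕ → Fin N} {l : ℕ} (hf : Function.Periodic f l) (p : ℕ) :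
    wordPow (wordOf f l) p = wordOf f (p * l) := flatten_replicate_wordOf hf p

theorem periodic_mul {α : Type*} {f : ℕ → α} {l : ℕ} (hf : Function.Periodic f l) (p : ℕ) :
    Function.Periodic f (p * l) := by
  rw [← Nat.nsmul_eq_mul]; exact hf.nsmul p

/-- The exponent of a power divides every letter count. -/
theorem isPrimitive_of_count {N : ℕ} {w : Word N}
    (h : ∀ q : ℕ, (∀ a, q ∣ w.count a) → q = 1) : IsPrimitive w := by
  rintro ⟨v, -, p, hp, rfl⟩
  have := h p fun a => by simp [wordPow, List.count_flatten]
  omega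

theorem not_isCircPrimitive_wordPow {N : ℕ} (v : Word N) {p : ℕ} (hp : 1 < p) :
    ¬ IsCircPrimitive (wordPow v p : CircWord N) := by
  rintro ⟨w, hw, hprim⟩
  apply hprim
  rcases eq_or_ne v [] with rfl | hv
  · have hn : wordPow ([] : Word N) p = [] := by simp [wordPow]
    obtain rfl : w = [] := by rwa [hn, Cycle.coe_nil, Cycle.coe_eq_nil] at hw
    exact ⟨[], List.infix_rfl, 2, by omega, by simp [wordPow]⟩
  obtain ⟨f, hf, hvf⟩ := exists_periodic_wordOf hv
  rw [hvf, wordPow_wordOf hf, coe_eq_coe_wordOf (periodic_mul hf p)] at hw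
  obtain ⟨r, rfl⟩ := hw
  refine ⟨wordOf (shift f r) v.length, ?_, p, hp, (wordPow_wordOf (periodic_shift hf r) p).symm⟩
  refine infix_wordOf.2 ⟨0, v.length, ?_, ?_⟩
  · rw [zero_add]; exact Nat.le_mul_of_pos_left _ (by omega)
  · rw [shift_shift, add_zero]

theorem isCircPow_wordOf {N : ℕ} {f : ℕ → Fin N} {l : ℕ} (hf : Function.Periodic f l) (p : ℕ) :
    IsCircPow (wordOf f (p * l) : CircWord N) (wordOf f l) p := by
  intro w hw
  obtain ⟨r, rfl⟩ := (coe_eq_coe_wordOf (periodic_mul hf p) w).1 hw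
  exact ⟨wordOf (shift f r) l, (coe_eq_coe_wordOf hf _).2 ⟨r, rfl⟩,
    (wordPow_wordOf (periodic_shift hf r) p).symm⟩

theorem IsCircPow.exists_wordPow {N : ℕ} {c d : CircWord N} {p : ℕ} (h : IsCircPow c d p) :
    ∃ v : Word N, (v : CircWord N) = d ∧ c = wordPow v p := by
  obtain ⟨w, rfl⟩ : ∃ w : Word N, (w : CircWord N) = c := Quotient.exists_rep c
  obtain ⟨v, hv, hw⟩ := h w rfl
  exact ⟨v, hv, by rw [hw]⟩

/-! ### The two families in terms of periodic sequences -/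

theorem coe_wordOf_shift {α : Type*} {f : ℕ → α} {l : ℕ} (hf : Function.Periodic f l) (r : ℕ) :
    (wordOf (shift f r) l : Cycle α) = wordOf f l := (coe_eq_coe_wordOf hf _).2 ⟨r, rfl⟩

/-- An even number of letters `0` per period brings the alternation back to its initial state. -/
theorem periodic_phiSeq_pathLetter {k m p : ℕ} (hk : 0 < k) (he : Even (p * k)) :
    Function.Periodic (phiSeq (pathLetter ((m : ℚ) / k))) (p * (k + m)) := by
  have hper := periodic_pathLetter m hk
  apply periodic_phiSeq (periodic_mul hper p)
  rwa [win_mul_period hper, (win_pathLetter_period m hk).1]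

theorem win_phiSeq_pathLetter {k m p : ℕ} (hk : 0 < k) (he : Even (p * k)) :
    2 * win (phiSeq (pathLetter ((m : ℚ) / k))) 0 0 (p * (k + m)) = p * k ∧
      2 * win (phiSeq (pathLetter ((m : ℚ) / k))) 1 0 (p * (k + m)) = p * k ∧
      win (phiSeq (pathLetter ((m : ℚ) / k))) 2 0 (p * (k + m)) = p * m := by
  have hper := periodic_pathLetter m hk
  obtain ⟨h0, h1⟩ := win_pathLetter_period m hk
  obtain ⟨w0, w1, w2⟩ := win_phiSeq (pathLetter ((m : ℚ) / k)) (p * (k + m))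
  rw [w0, w1, w2, win_mul_period hper, win_mul_period hper, h0, h1]
  obtain ⟨t, ht⟩ := he
  omega

theorem phi_wordPow_christoffel {k : ℕ} (m p : ℕ) (hk : 0 < k) :
    phi (wordPow (christoffel k m) p) =
      wordOf (phiSeq (pathLetter ((m : ℚ) / k))) (p * (k + m)) := by
  rw [← phi_wordOf, ← wordPow_wordOf (periodic_pathLetter m hk)]
  rfl

theorem mem_permImages_circ_iff {N : ℕ} {X : Set (Word N)} {c : CircWord N} :
    c ∈ permImages (circ X) ↔
      ∃ σ : Equiv.Perm (Fin N), ∃ w ∈ X, c = ((w.map σ : Word N) : CircWord N) := by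
  constructor
  · rintro ⟨σ, d, ⟨w, hw, rfl⟩, rfl⟩
    exact ⟨σ, w, hw, Cycle.map_coe _ _⟩
  · rintro ⟨σ, w, hw, rfl⟩
    exact ⟨σ, _, ⟨w, hw, rfl⟩, (Cycle.map_coe _ _).symm⟩

theorem mem_permImages_evenChristoffelPowers_iff {c : CircWord 3} :
    c ∈ permImages (circ (phi '' evenChristoffelPowers)) ↔
      ∃ (σ : Equiv.Perm (Fin 3)) (k m p : ℕ), 0 < k ∧ 0 < m ∧ Nat.Coprime k m ∧ 1 ≤ p ∧
        Even (p * k) ∧ c = wordOf (σ ∘ phiSeq (pathLetter ((m : ℚ) / k))) (p * (k + m)) := by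
  have hcount : ∀ k m p : ℕ, 0 < k → (wordPow (christoffel k m) p).count 0 = p * k := by
    intro k m p hk
    rw [show christoffel k m = wordOf (pathLetter ((m : ℚ) / k)) (k + m) from rfl,
      wordPow_wordOf (periodic_pathLetter m hk), count_wordOf,
      win_mul_period (periodic_pathLetter m hk), (win_pathLetter_period m hk).1]
  rw [mem_permImages_circ_iff]
  constructor
  · rintro ⟨σ, _, ⟨w, ⟨⟨_, ⟨k, m, hk, hm, hco, rfl⟩, p, hp, rfl⟩, he⟩, rfl⟩, rfl⟩
    refine ⟨σ, k, m, p, hk, hm, hco, hp, hcount k m p hk ▸ he, ?_⟩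
    rw [phi_wordPow_christoffel m p hk, map_wordOf]
  · rintro ⟨σ, k, m, p, hk, hm, hco, hp, he, rfl⟩
    refine ⟨σ, _, ⟨_, ⟨⟨_, ⟨k, m, hk, hm, hco, rfl⟩, p, hp, rfl⟩, ?_⟩, rfl⟩, ?_⟩
    · rwa [hcount k m p hk]
    · rw [phi_wordPow_christoffel m p hk, map_wordOf]

theorem mem_permImages_evenChristoffelWords_iff {c : CircWord 3} :
    c ∈ permImages (circ (phi '' evenChristoffelWords)) ↔
      ∃ (σ : Equiv.Perm (Fin 3)) (k m : ℕ), 0 < k ∧ 0 < m ∧ Nat.Coprime k m ∧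
        c = wordOf (σ ∘ phiSeq (pathLetter ((m : ℚ) / k))) ((if Even k then 1 else 2) * (k + m)) := by
  rw [mem_permImages_circ_iff]
  constructor
  · rintro ⟨σ, _, ⟨w, ⟨k, m, hk, hm, hco, rfl⟩, rfl⟩, rfl⟩
    exact ⟨σ, k, m, hk, hm, hco, by rw [phi_wordPow_christoffel m _ hk, map_wordOf]⟩
  · rintro ⟨σ, k, m, hk, hm, hco, rfl⟩
    exact ⟨σ, _, ⟨_, ⟨k, m, hk, hm, hco, rfl⟩, rfl⟩,
      by rw [phi_wordPow_christoffel m _ hk, map_wordOf]⟩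

/-! ### The Fraenkel family. -/

theorem periodic_fraenkelSeq : Function.Periodic fraenkelSeq 7 := fun n => by
  simp [fraenkelSeq]

theorem win_fraenkelSeq (n : ℕ) : win fraenkelSeq 0 0 n = (4 * n + 1) / 7 ∧
    win fraenkelSeq 1 0 n = (2 * n + 2) / 7 ∧ win fraenkelSeq 2 0 n = (1 * n + 6) / 7 := by
  induction n with
  | zero => simp [win_zero]
  | succ n ih =>
    simp only [win_succ, zero_add, ih, fraenkelSeq]
    by_cases h0 : n % 7 = 0
    · simp [h0]; omega
    · by_cases h1 : n % 7 = 2 ∨ n % 7 = 5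
      · simp [h0, h1]; omega
      · have : n % 7 = 1 ∨ n % 7 = 3 ∨ n % 7 = 4 ∨ n % 7 = 6 := by omega
        simp only [h0, h1, if_false]
        simp
        rcases this with h | h | h | h <;> omega

theorem seqBalanced_fraenkelSeq : SeqBalanced fraenkelSeq := by
  apply seqBalanced_of_div
  intro a
  rcases fin_three_cases a with rfl | rfl | rfl
  · exact ⟨4, 1, 7, by omega, fun n => (win_fraenkelSeq n).1⟩
  · exact ⟨2, 2, 7, by omega, fun n => (win_fraenkelSeq n).2.1⟩
  · exact ⟨1, 6, 7, by omega, fun n => (win_fraenkelSeq n).2.2⟩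

theorem win_fraenkelSeq_mul (p : ℕ) : win fraenkelSeq 0 0 (p * 7) = 4 * p ∧
    win fraenkelSeq 1 0 (p * 7) = 2 * p ∧ win fraenkelSeq 2 0 (p * 7) = p := by
  obtain ⟨h0, h1, h2⟩ := win_fraenkelSeq (p * 7)
  omega

theorem mem_fraenkelCirc_iff {c : CircWord 3} :
    c ∈ fraenkelCirc ↔ ∃ σ : Equiv.Perm (Fin 3), c = wordOf (σ ∘ fraenkelSeq) 7 := by
  -- The sequence reads `2010010`; rotating by four moves its `2` to the centre.
  have e : (wordOf fraenkelSeq 7).rotate 4 = fraenkel₃ := by decide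
  have h : ∀ σ : Equiv.Perm (Fin 3),
      ((fraenkel₃.map σ : Word 3) : CircWord 3) = wordOf (σ ∘ fraenkelSeq) 7 := by
    intro σ
    rw [← map_wordOf, ← e, List.map_rotate, eq_comm, Cycle.coe_eq_coe]
    exact ⟨4, rfl⟩
  rw [fraenkelCirc, mem_permImages_circ_iff]
  constructor
  · rintro ⟨σ, _, rfl, rfl⟩
    exact ⟨σ, h σ⟩
  · rintro ⟨σ, rfl⟩
    exact ⟨σ, _, rfl, (h σ).symm⟩

theorem mem_fraenkelCircPowers_iff {c : CircWord 3} :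
    c ∈ fraenkelCircPowers ↔ ∃ (σ : Equiv.Perm (Fin 3)) (p : ℕ), 1 ≤ p ∧
      c = wordOf (σ ∘ fraenkelSeq) (p * 7) := by
  have hper : ∀ σ : Equiv.Perm (Fin 3), Function.Periodic (σ ∘ fraenkelSeq) 7 := fun σ =>
    periodic_fraenkelSeq.comp σ
  constructor
  · rintro ⟨d, hd, p, hp, hc⟩
    obtain ⟨σ, rfl⟩ := mem_fraenkelCirc_iff.1 hd
    obtain ⟨v, hv, rfl⟩ := hc.exists_wordPow
    obtain ⟨r, rfl⟩ := (coe_eq_coe_wordOf (hper σ) v).1 hv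
    refine ⟨σ, p, hp, ?_⟩
    rw [wordPow_wordOf (periodic_shift (hper σ) r), coe_wordOf_shift (periodic_mul (hper σ) p)]
  · rintro ⟨σ, p, hp, rfl⟩
    exact ⟨_, mem_fraenkelCirc_iff.2 ⟨σ, rfl⟩, p, hp, isCircPow_wordOf (hper σ) p⟩

/-! ### Spectra -/

/-- The counts sum to `n`, so the number of letters at their upper value is constant. It is neither
zero nor three, hence one letter is always exceptional, and it determines the Parikh vector. -/
theorem circAbComplexity_eq_three {f : ℕ → Fin 3} {l n : ℕ} (hf : Function.Periodic f l)
    (hn : n ≤ l) (t : Fin 3 → ℕ) (ht : ∀ a i, win f a i n = t a ∨ win f a i n = t a + 1)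
    (h0 : ∀ a, ∃ i, win f a i n = t a) (h1 : ∀ a, ∃ i, win f a i n = t a + 1) :
    circAbComplexity n (wordOf f l : CircWord 3) = 3 := by
  have hsum := fun i => win_sum_three f i n
  have ncard : ∀ e d : ℕ, e ≠ d → (Set.range fun b : Fin 3 => fun a : Fin 3 =>
      ((t a + if a = b then e else d : ℕ) : ℤ)).ncard = 3 := by
    intro e d hed
    rw [← Set.image_univ, Set.ncard_image_of_injective, Set.ncard_univ, Nat.card_fin]
    intro b b' hbb
    by_contra hne
    have := congrFun hbb b
    simp only [if_true, if_neg hne] at this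
    omega
  rw [circAbComplexity, circSpec_wordOf hf hn]
  -- Here `e` is the excess over `t` of the exceptional letter and `d` that of the other two.
  have key : ∀ e d : ℕ, e + 2 * d + t 0 + t 1 + t 2 = n → e + d = 1 →
      {x : Fin 3 → ℤ | ∃ i, x = fun a => (win f a i n : ℤ)} =
        Set.range fun b : Fin 3 => fun a : Fin 3 => ((t a + if a = b then e else d : ℕ) : ℤ) := by
    intro e d hsed hed
    have hall : ∀ i b, win f b i n = t b + e →
        (fun a => ((t a + if a = b then e else d : ℕ) : ℤ)) = fun a => (win f a i n : ℤ) := by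
      intro i b hb
      have g0 := ht 0 i
      have g1 := ht 1 i
      have g2 := ht 2 i
      have := hsum i
      funext a
      congr 1
      rcases fin_three_cases a with rfl | rfl | rfl <;>
        rcases fin_three_cases b with rfl | rfl | rfl <;> simp <;> omega
    ext x
    constructor
    · rintro ⟨i, rfl⟩
      have g0 := ht 0 i
      have g1 := ht 1 i
      have g2 := ht 2 i
      have := hsum i
      have : win f 0 i n = t 0 + e ∨ win f 1 i n = t 1 + e ∨ win f 2 i n = t 2 + e := by omega
      rcases this with h | h | h
      · exact ⟨0, hall i 0 h⟩
      · exact ⟨1, hall i 1 h⟩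
      · exact ⟨2, hall i 2 h⟩
    · rintro ⟨b, rfl⟩
      have : ∃ i, win f b i n = t b + e := by
        rcases (by omega : e = 0 ∨ e = 1) with rfl | rfl
        · exact h0 b
        · exact h1 b
      obtain ⟨i, hi⟩ := this
      exact ⟨i, hall i b hi⟩
  obtain ⟨i, hi⟩ := h0 0
  obtain ⟨i', hi'⟩ := h1 0
  have g1 := ht 1 i
  have g2 := ht 2 i
  have g1' := ht 1 i'
  have g2' := ht 2 i'
  have s := hsum i
  have s' := hsum i'
  rcases (by omega : 1 + t 0 + t 1 + t 2 = n ∨ 2 + t 0 + t 1 + t 2 = n) with h | h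
  · rw [key 1 0 (by omega) (by omega), ncard 1 0 (by omega)]
  · rw [key 0 1 (by omega) (by omega), ncard 0 1 (by omega)]

theorem attainedByNontrivialSpectra_of_coprime {f : ℕ → Fin 3} {l : ℕ}
    (hf : Function.Periodic f l) (hb : SeqBalanced f) (hc : ∀ a, Nat.Coprime l (win f a 0 l)) :
    AttainedByNontrivialSpectra 3 (wordOf f l : CircWord 3) := by
  intro n hn1 hn hne
  rw [Cycle.length_coe, length_wordOf] at hn
  rcases hn.lt_or_eq with hlt | rfl
  · have hvar : ∀ a, ∃ t, (∀ i, win f a i n = t ∨ win f a i n = t + 1) ∧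
        (∃ i, win f a i n = t) ∧ ∃ i, win f a i n = t + 1 := by
      intro a
      have hnc : ∃ i, win f a i n ≠ win f a 0 n := by
        by_contra! hcon
        -- If all windows of length `n` agreed, tiling `n` periods by `l` of them would make `l`
        -- divide `n` times a count coprime to `l`.
        have h1 : ∀ t, win f a 0 (t * n) = t * win f a 0 n := by
          intro t
          induction t with
          | zero => simp [win_zero]
          | succ t ih => rw [Nat.add_one_mul, win_add, ih, hcon (0 + t * n), Nat.add_one_mul]
        have h2 := h1 l
        rw [mul_comm l n, win_mul_period hf] at h2
        have h3 : l ∣ n := (hc a).dvd_of_dvd_mul_right (h2 ▸ Dvd.intro _ rfl)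
        exact absurd (Nat.le_of_dvd (by omega) h3) (by omega)
      obtain ⟨i, hi⟩ := hnc
      have b1 := hb a i 0 n
      have b2 := hb a 0 i n
      rcases lt_or_gt_of_ne hi with h | h
      · refine ⟨win f a i n, fun j => ?_, ⟨i, rfl⟩, 0, by omega⟩
        have := hb a 0 j n
        have := hb a j i n
        omega
      · refine ⟨win f a 0 n, fun j => ?_, ⟨0, rfl⟩, i, by omega⟩
        have := hb a i j n
        have := hb a j 0 n
        omega
    choose t h1 h2 h3 using hvar
    exact circAbComplexity_eq_three hf hn t h1 h2 h3
  · exfalso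
    apply hne
    rw [circAbComplexity, circSpec_wordOf hf le_rfl]
    simp only [win_period hf, exists_const, Set.ofPred_eq_eq_singleton, Set.ncard_singleton]

theorem boundK_three : boundK 3 = 3 := by decide

/-! ### Classification -/

theorem exists_perm_of_ne {a b : Fin 3} (h : a ≠ b) :
    ∃ τ : Equiv.Perm (Fin 3), τ 0 = a ∧ τ 1 = b := by
  revert a b; decide

theorem exists_perm_sorted {v : Fin 3 → ℕ} (h : ∀ a b, a ≠ b → v a ≠ v b) :
    ∃ τ : Equiv.Perm (Fin 3), v (τ 2) < v (τ 1) ∧ v (τ 1) < v (τ 0) := by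
  have perm : ∀ a b c : Fin 3, a ≠ b → a ≠ c → b ≠ c →
      ∃ τ : Equiv.Perm (Fin 3), τ 0 = a ∧ τ 1 = b ∧ τ 2 = c := by decide
  have use : ∀ a b c : Fin 3, a ≠ b → a ≠ c → b ≠ c → v c < v b → v b < v a →
      ∃ τ : Equiv.Perm (Fin 3), v (τ 2) < v (τ 1) ∧ v (τ 1) < v (τ 0) := by
    intro a b c hab hac hbc h1 h2
    obtain ⟨τ, rfl, rfl, rfl⟩ := perm a b c hab hac hbc
    exact ⟨τ, h1, h2⟩
  have h01 := h 0 1 (by decide)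
  have h02 := h 0 2 (by decide)
  have h12 := h 1 2 (by decide)
  rcases lt_or_gt_of_ne h01 with h01 | h01 <;> rcases lt_or_gt_of_ne h02 with h02 | h02 <;>
    rcases lt_or_gt_of_ne h12 with h12 | h12
  · exact use 2 1 0 (by decide) (by decide) (by decide) h01 h12
  · exact use 1 2 0 (by decide) (by decide) (by decide) h02 h12
  · omega
  · exact use 1 0 2 (by decide) (by decide) (by decide) h02 h01
  · exact use 2 0 1 (by decide) (by decide) (by decide) h01 h02
  · omega
  · exact use 0 2 1 (by decide) (by decide) (by decide) h12 h02
  · exact use 0 1 2 (by decide) (by decide) (by decide) h12 h01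

theorem balancedCirc_three_subset : balancedCirc 3 ⊆
    permImages (circ (phi '' evenChristoffelPowers)) ∪ fraenkelCircPowers := by
  intro c hc
  obtain ⟨w, hw, rfl⟩ := hc.1
  have hne : w ≠ [] := by
    rintro rfl
    simpa using (mem_fullWords_iff _).1 hw 0
  obtain ⟨f, hf, hwf⟩ := exists_periodic_wordOf hne
  have hl : 0 < w.length := List.length_pos_iff.2 hne
  generalize w.length = l at *
  subst hwf
  obtain ⟨hb, hpos⟩ := (mem_balancedCirc_iff hf hl).1 hc
  by_cases heq : ∃ a b, a ≠ b ∧ win f a 0 l = win f b 0 l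
  · left
    obtain ⟨a, b, hab, hwab⟩ := heq
    obtain ⟨τ, rfl, rfl⟩ := exists_perm_of_ne hab
    have hg : Function.Periodic (τ.symm ∘ f) l := hf.comp _
    have hwin : ∀ x, win (τ.symm ∘ f) x 0 l = win f (τ x) 0 l := fun x => by
      rw [win_comp_equiv, Equiv.symm_symm]
    obtain ⟨r, k, m, p, σ, hk, hm, hco, hp, he, hlp, hr⟩ :=
      exists_shift_eq_phiSeq (hb.comp_equiv τ.symm) hg (by rw [hwin]; exact hpos _)
        (by rw [hwin, hwin, hwab]) (by rw [hwin]; exact hpos _)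
    refine mem_permImages_evenChristoffelPowers_iff.2
      ⟨σ.trans τ, k, m, p, hk, hm, hco, hp, he, ?_⟩
    rw [← coe_wordOf_shift hf r, ← hlp, Equiv.coe_trans, Function.comp_assoc, ← hr]
    congr 2
    funext i
    simp [shift]
  · right
    push Not at heq
    obtain ⟨τ, h21, h10⟩ := exists_perm_sorted (v := fun a => win f a 0 l) heq
    have hg : Function.Periodic (τ.symm ∘ f) l := hf.comp _
    have hwin : ∀ x, win (τ.symm ∘ f) x 0 l = win f (τ x) 0 l := fun x => by
      rw [win_comp_equiv, Equiv.symm_symm]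
    obtain ⟨r, hr⟩ := exists_fraenkelSeq (hb.comp_equiv τ.symm) hg (by rw [hwin]; exact hpos _)
      (by rw [hwin, hwin]; exact h21) (by rw [hwin, hwin]; exact h10)
    -- The letter `2` at index `0` recurs at index `l`, and the Fraenkel sequence has `2` only at
    -- multiples of seven.
    have h7 : 7 ∣ l := by
      have := periodic_shift hg r 0
      rw [hr, zero_add, fraenkelSeq, fraenkelSeq] at this
      split_ifs at this with h h' <;> omega
    obtain ⟨p, rfl⟩ := h7
    refine mem_fraenkelCircPowers_iff.2 ⟨τ, p, by omega, ?_⟩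
    rw [← coe_wordOf_shift hf r, mul_comm, ← hr]
    congr 2
    funext i
    simp [shift]

theorem permImages_evenChristoffelPowers_subset :
    permImages (circ (phi '' evenChristoffelPowers)) ⊆ balancedCirc 3 := by
  intro c hc
  obtain ⟨σ, k, m, p, hk, hm, -, hp, he, rfl⟩ := mem_permImages_evenChristoffelPowers_iff.1 hc
  rw [mem_balancedCirc_iff ((periodic_phiSeq_pathLetter hk he).comp σ)
    (Nat.mul_pos hp (by omega))]
  refine ⟨(seqBalanced_phiSeq m hk).comp_equiv σ, fun a => ?_⟩
  rw [win_comp_equiv]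
  obtain ⟨h0, h1, h2⟩ := win_phiSeq_pathLetter (m := m) hk he
  have hpk := Nat.mul_pos hp hk
  have hpm := Nat.mul_pos hp hm
  rcases fin_three_cases (σ.symm a) with h | h | h <;> rw [h] <;> omega

theorem fraenkelCircPowers_subset : fraenkelCircPowers ⊆ balancedCirc 3 := by
  intro c hc
  obtain ⟨σ, p, hp, rfl⟩ := mem_fraenkelCircPowers_iff.1 hc
  rw [mem_balancedCirc_iff ((periodic_mul periodic_fraenkelSeq p).comp σ) (by omega)]
  refine ⟨seqBalanced_fraenkelSeq.comp_equiv σ, fun a => ?_⟩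
  rw [win_comp_equiv]
  obtain ⟨h0, h1, h2⟩ := win_fraenkelSeq_mul p
  rcases fin_three_cases (σ.symm a) with h | h | h <;> rw [h] <;> omega

/-- Two letters are equally frequent in the first family, while the frequencies in the second are in
ratio `4 : 2 : 1`. -/
theorem disjoint_christoffel_fraenkel :
    Disjoint (permImages (circ (phi '' evenChristoffelPowers))) fraenkelCircPowers := by
  rw [Set.disjoint_left]
  intro c hc hc'
  obtain ⟨σ, k, m, p, hk, -, -, -, he, rfl⟩ := mem_permImages_evenChristoffelPowers_iff.1 hc
  obtain ⟨τ, q, hq, h⟩ := mem_fraenkelCircPowers_iff.1 hc'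
  have hcount : ∀ a, win (σ ∘ phiSeq (pathLetter ((m : ℚ) / k))) a 0 (p * (k + m)) =
      win (τ ∘ fraenkelSeq) a 0 (q * 7) := fun a => by
    rw [← count_wordOf, ← count_wordOf]
    exact (Cycle.coe_eq_coe.1 h).perm.count_eq a
  have h0 := hcount (σ 0)
  have h1 := hcount (σ 1)
  rw [win_comp_equiv, win_comp_equiv, Equiv.symm_apply_apply] at h0 h1
  have hne : τ.symm (σ 0) ≠ τ.symm (σ 1) := by simp
  obtain ⟨p0, p1, -⟩ := win_phiSeq_pathLetter (m := m) hk he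
  obtain ⟨f0, f1, f2⟩ := win_fraenkelSeq_mul q
  rcases fin_three_cases (τ.symm (σ 0)) with e | e | e <;>
    rcases fin_three_cases (τ.symm (σ 1)) with e' | e' | e' <;>
    rw [e] at h0 hne <;> rw [e'] at h1 hne <;> omega

/-! ### Primitive members of the two families. -/

theorem isCircPrimitive_wordOf {N : ℕ} {f : ℕ → Fin N} {l : ℕ} (σ : Equiv.Perm (Fin N))
    (h : ∀ q, (∀ a, q ∣ win f a 0 l) → q = 1) :
    IsCircPrimitive (wordOf (σ ∘ f) l : CircWord N) := by
  refine ⟨_, rfl, isPrimitive_of_count fun q hq => h q fun a => ?_⟩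
  have := hq (σ a)
  rwa [count_wordOf, win_comp_equiv, Equiv.symm_apply_apply] at this

theorem even_mul_ite (k : ℕ) : Even ((if Even k then 1 else 2) * k) := by
  split_ifs with h
  · simpa using h
  · exact even_two.mul_right k

theorem permImages_evenChristoffelWords_subset :
    permImages (circ (phi '' evenChristoffelWords)) ⊆
      permImages (circ (phi '' evenChristoffelPowers)) := by
  intro c hc
  obtain ⟨σ, k, m, hk, hm, hco, rfl⟩ := mem_permImages_evenChristoffelWords_iff.1 hc
  exact mem_permImages_evenChristoffelPowers_iff.2
    ⟨σ, k, m, _, hk, hm, hco, by split_ifs <;> omega, even_mul_ite k, rfl⟩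

/-- The letter counts are `k / 2, k / 2, m` for even `k` and `k, k, 2 * m` for odd `k`; either
triple has no common divisor beyond one. -/
theorem isCircPrimitive_of_mem_evenChristoffelWords {c : CircWord 3}
    (hc : c ∈ permImages (circ (phi '' evenChristoffelWords))) : IsCircPrimitive c := by
  obtain ⟨σ, k, m, hk, hm, hco, rfl⟩ := mem_permImages_evenChristoffelWords_iff.1 hc
  apply isCircPrimitive_wordOf
  intro q hq
  obtain ⟨h0, -, h2⟩ := win_phiSeq_pathLetter (m := m) hk (even_mul_ite k)
  have q0 := hq 0
  have q2 := hq 2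
  split_ifs at h0 h2 q0 q2 with he
  · rw [h2, one_mul] at q2
    have q0' : q ∣ k := by rw [← one_mul k, ← h0]; exact q0.mul_left 2
    exact Nat.eq_one_of_dvd_coprimes hco q0' q2
  · rw [h2] at q2
    have q0' : q ∣ k := by rwa [Nat.eq_of_mul_eq_mul_left (by omega) h0] at q0
    have hk2 : Nat.Coprime k 2 := by
      rwa [Nat.coprime_two_right, ← Nat.not_even_iff_odd]
    exact Nat.eq_one_of_dvd_coprimes (hk2.mul_right hco) q0' q2

theorem mem_evenChristoffelWords_of_isCircPrimitive {c : CircWord 3}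
    (hc : c ∈ permImages (circ (phi '' evenChristoffelPowers))) (hprim : IsCircPrimitive c) :
    c ∈ permImages (circ (phi '' evenChristoffelWords)) := by
  obtain ⟨σ, k, m, p, hk, hm, hco, hp, he, rfl⟩ := mem_permImages_evenChristoffelPowers_iff.1 hc
  refine mem_permImages_evenChristoffelWords_iff.2 ⟨σ, k, m, hk, hm, hco, ?_⟩
  -- Evenness of `p * k` makes the minimal admissible exponent divide `p`; the quotient `q` is then
  -- an exponent of the ternary word itself.
  obtain ⟨q, rfl⟩ : (if Even k then 1 else 2) ∣ p := by
    split_ifs with hk'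
    · exact one_dvd p
    · exact (Nat.even_mul.1 he).resolve_right hk' |>.two_dvd
  have hper : Function.Periodic (σ ∘ phiSeq (pathLetter ((m : ℚ) / k)))
      ((if Even k then 1 else 2) * (k + m)) :=
    (periodic_phiSeq_pathLetter hk (even_mul_ite k)).comp σ
  rw [mul_comm _ q, mul_assoc, ← wordPow_wordOf hper] at hprim ⊢
  have hq : ¬ 1 < q := fun h => not_isCircPrimitive_wordPow _ h hprim
  have hq1 : q = 1 := by
    rcases Nat.eq_zero_or_pos q with rfl | h
    · simp at hp
    · omega
  simp [hq1, wordPow]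

theorem fraenkelCirc_subset : fraenkelCirc ⊆ fraenkelCircPowers := by
  intro c hc
  obtain ⟨σ, rfl⟩ := mem_fraenkelCirc_iff.1 hc
  exact mem_fraenkelCircPowers_iff.2 ⟨σ, 1, le_rfl, by rw [one_mul]⟩

theorem isCircPrimitive_of_mem_fraenkelCirc {c : CircWord 3} (hc : c ∈ fraenkelCirc) :
    IsCircPrimitive c := by
  obtain ⟨σ, rfl⟩ := mem_fraenkelCirc_iff.1 hc
  apply isCircPrimitive_wordOf
  intro q hq
  have h := hq 2
  rw [(win_fraenkelSeq 7).2.2] at h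
  simpa using h

theorem mem_fraenkelCirc_of_isCircPrimitive {c : CircWord 3} (hc : c ∈ fraenkelCircPowers)
    (hprim : IsCircPrimitive c) : c ∈ fraenkelCirc := by
  obtain ⟨σ, p, hp, rfl⟩ := mem_fraenkelCircPowers_iff.1 hc
  rcases hp.lt_or_eq with h | rfl
  · rw [← wordPow_wordOf (periodic_fraenkelSeq.comp σ)] at hprim
    exact absurd hprim (not_isCircPrimitive_wordPow _ h)
  · exact mem_fraenkelCirc_iff.2 ⟨σ, by rw [one_mul]⟩

theorem attained_of_mem_fraenkelCirc {c : CircWord 3} (hc : c ∈ fraenkelCirc) :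
    AttainedByNontrivialSpectra 3 c := by
  obtain ⟨σ, rfl⟩ := mem_fraenkelCirc_iff.1 hc
  apply attainedByNontrivialSpectra_of_coprime (periodic_fraenkelSeq.comp σ)
    (seqBalanced_fraenkelSeq.comp_equiv σ)
  intro a
  rw [win_comp_equiv]
  obtain ⟨h0, h1, h2⟩ := win_fraenkelSeq_mul 1
  rcases fin_three_cases (σ.symm a) with h | h | h <;> rw [h]
  · rw [h0]; decide
  · rw [h1]; decide
  · rw [h2]; decide

theorem attained_of_mem_phi_christoffel {k m : ℕ} (hk : 0 < k) (hco : Nat.Coprime k m)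
    (he : Even k) {c : CircWord 3} (hc : c ∈ permImages (circ {phi (christoffel k m)})) :
    AttainedByNontrivialSpectra 3 c := by
  obtain ⟨σ, _, rfl, rfl⟩ := mem_permImages_circ_iff.1 hc
  have he' : Even (1 * k) := by rwa [one_mul]
  have hper := periodic_phiSeq_pathLetter (m := m) hk he'
  obtain ⟨h0, h1, h2⟩ := win_phiSeq_pathLetter (m := m) hk he'
  rw [one_mul] at hper
  simp only [one_mul] at h0 h1 h2
  rw [show christoffel k m = wordOf (pathLetter ((m : ℚ) / k)) (k + m) from rfl, phi_wordOf,
    map_wordOf]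
  apply attainedByNontrivialSpectra_of_coprime (hper.comp σ)
    ((seqBalanced_phiSeq m hk).comp_equiv σ)
  intro a
  rw [win_comp_equiv]
  have ck : Nat.Coprime (k + m) k := by simpa [Nat.coprime_comm] using hco
  have cm : Nat.Coprime (k + m) m := by simpa using hco
  rcases fin_three_cases (σ.symm a) with h | h | h <;> rw [h]
  · exact ck.coprime_dvd_right ⟨2, by omega⟩
  · exact ck.coprime_dvd_right ⟨2, by omega⟩
  · rwa [h2]

end CircularWords

theorem theorem1 :
    (CircularWords.balancedCirc 3 =
        CircularWords.permImages
          (CircularWords.circ (CircularWords.phi '' CircularWords.evenChristoffelPowers)) ∪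
        CircularWords.fraenkelCircPowers ∧
      Disjoint
        (CircularWords.permImages
          (CircularWords.circ (CircularWords.phi '' CircularWords.evenChristoffelPowers)))
        CircularWords.fraenkelCircPowers) ∧
    (CircularWords.primBalancedCirc 3 =
        CircularWords.permImages
          (CircularWords.circ (CircularWords.phi '' CircularWords.evenChristoffelWords)) ∪
        CircularWords.fraenkelCirc ∧
      Disjoint
        (CircularWords.permImages
          (CircularWords.circ (CircularWords.phi '' CircularWords.evenChristoffelWords)))
        CircularWords.fraenkelCirc) ∧
    (∀ c ∈ CircularWords.fraenkelCirc,
      CircularWords.AttainedByNontrivialSpectra (CircularWords.boundK 3) c) ∧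
    (∀ k m : ℕ, 0 < k → 0 < m → Nat.Coprime k m → Even k →
      ∀ c ∈ CircularWords.permImages
          (CircularWords.circ {CircularWords.phi (CircularWords.christoffel k m)}),
        CircularWords.AttainedByNontrivialSpectra (CircularWords.boundK 3) c) := by
  open CircularWords in
  refine ⟨⟨?_, disjoint_christoffel_fraenkel⟩, ⟨?_, ?_⟩, ?_, ?_⟩
  · exact Set.Subset.antisymm balancedCirc_three_subset
      (Set.union_subset permImages_evenChristoffelPowers_subset fraenkelCircPowers_subset)
  · ext c
    constructor
    · rintro ⟨hc, hprim⟩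
      exact (balancedCirc_three_subset hc).imp
        (fun h => mem_evenChristoffelWords_of_isCircPrimitive h hprim)
        (fun h => mem_fraenkelCirc_of_isCircPrimitive h hprim)
    · rintro (hc | hc)
      · exact ⟨permImages_evenChristoffelPowers_subset (permImages_evenChristoffelWords_subset hc),
          isCircPrimitive_of_mem_evenChristoffelWords hc⟩
      · exact ⟨fraenkelCircPowers_subset (fraenkelCirc_subset hc),
          isCircPrimitive_of_mem_fraenkelCirc hc⟩
  · exact disjoint_christoffel_fraenkel.mono permImages_evenChristoffelWords_subset
      fraenkelCirc_subset
  · intro c hc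
    rw [boundK_three]
    exact attained_of_mem_fraenkelCirc hc
  · intro k m hk _ hco he c hc
    rw [boundK_three]
    exact attained_of_mem_phi_christoffel hk hco he hc
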